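/- Let $k$ be an algebraically closed field. For a partition $\mu$, let $\mu'$ be its transpose and let $N_\mu$ be the $k$-vector space with nilpotent operator $T$ whose Jordan blocks have sizes $\mu_1,\mu_2,\dots$. Let $\alpha,\beta,\gamma$ be partitions with $\gamma\subseteq\beta$ such that $\beta\setminus\gamma$ is a rook strip (at most one box in each row and in each column). Let $\mathbb V_{\alpha,\gamma}^\beta\subseteq \operatorname{Hom}_k(N_\alpha,N_\beta)$, with the subspace topology of the Zariski topology, be the set of all injective $k[T]$-homomorphisms $f:N_\alpha\to N_\beta$ with $\operatorname{Coker} f\cong N_\gamma$. Let $\mathcal T$ be the set of Littlewood–Richardson fillings of shape $\beta'\setminus\gamma'$ and content $\alpha'$: the boxes are filled with $\alpha'_u$ entries $u$ for each $u\ge 1$, rows weakly increase, columns strictly increase, and for each $u>1$ and each column $c$ there are, to the right of $c$, at least as many entries $u-1$ as entries $u$. For $X\in\mathcal T$ and $\ell\ge 0$, let $X^{(\ell)}$ be the partition formed by $\gamma'$ and the boxes with entry at most $\ell$. Put $Z\le_{\sf dom}X$ if $X^{(\ell)}$ dominates $Z^{(\ell)}$ for every $\ell$, i.e. if for all $\ell$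 and $j$ the sum of the first $j$ parts of $Z^{(\ell)}$ is at most that of $X^{(\ell)}$. Let $\mathbb V_X$ be the set of those $f\in\mathbb V_{\alpha,\gamma}^\beta$ such that, with $A=f(N_\alpha)$, one has $N_\beta/T^\ell A\cong N_{(X^{(\ell)})'}$ for all $\ell\ge 0$. Assume that $\mathcal T\neq\emptyset$. Then $\mathbb V_{\alpha,\gamma}^\beta=\bigcup_{X\in\mathcal T}\mathbb V_X$, the components $\mathbb V_X$ of this decomposition are non-empty and pairwise disjoint, and the poset $(\mathcal T,\le_{\sf dom})$ has exactly one minimal element $O$ and exactly one maximal element $C$. Among the components $\mathbb V_X$, $X\in\mathcal T$, the component $\mathbb V_O$ is the only one that is open in $\mathbb V_{\alpha,\gamma}^\beta$, and $\mathbb V_C$ is the only one that is closed in $\mathbb V_{\alpha,\gamma}^\beta$. -/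

import Mathlib

namespace LRVar

/-! ### Partitions, skew shapes and Littlewood-Richardson fillings

Partitions are Young diagrams: the `i`-th part (counted from `0`) is `μ.rowLen i`, and the
transposed partition is `μ.transpose`. -/

/-- The skew diagram `β ∖ γ` is a vertical strip: `β_i ≤ γ_i + 1` for all `i`. -/
def IsVerticalStrip (β γ : YoungDiagram) : Prop :=
  ∀ i, β.rowLen i ≤ γ.rowLen i + 1

/-- The skew diagram `β ∖ γ` is a horizontal strip: `β' ∖ γ'` is a vertical strip. -/
def IsHorizontalStrip (β γ : YoungDiagram) : Prop :=
  IsVerticalStrip β.transpose γ.transpose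

/-- A rook strip is a horizontal and vertical strip. -/
def IsRookStrip (β γ : YoungDiagram) : Prop :=
  IsHorizontalStrip β γ ∧ IsVerticalStrip β γ

/-- The dominance order on partitions: `μ_1 + ⋯ + μ_j ≤ ν_1 + ⋯ + ν_j` for all `j`. -/
def DomLE (μ ν : YoungDiagram) : Prop :=
  ∀ j, ∑ i ∈ Finset.range j, μ.rowLen i ≤ ∑ i ∈ Finset.range j, ν.rowLen i

/-- LR-fillings of shape `β ∖ γ` and content `α`. The box in row `i` and column `j` (counted
from `0`, top to bottom and left to right) is `(i, j)`, with entry `entry (i, j)`; by convention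
`entry` is `0` off the skew shape. -/
@[ext]
structure LRFilling (α β γ : YoungDiagram) where
  entry : ℕ × ℕ → ℕ
  zero_off : ∀ c, c ∉ β.cells \ γ.cells → entry c = 0
  pos : ∀ c ∈ β.cells \ γ.cells, 0 < entry c
  row_weak : ∀ i j₁ j₂, j₁ < j₂ → (i, j₁) ∈ β.cells \ γ.cells → (i, j₂) ∈ β.cells \ γ.cells →
    entry (i, j₁) ≤ entry (i, j₂)
  col_strict : ∀ i₁ i₂ j, i₁ < i₂ → (i₁, j) ∈ β.cells \ γ.cells → (i₂, j) ∈ β.cells \ γ.cells →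
    entry (i₁, j) < entry (i₂, j)
  /-- The number of entries `u + 1` is the part `α_{u+1}`, which is `α.rowLen u`. -/
  content : ∀ u, ((β.cells \ γ.cells).filter fun c => entry c = u + 1).card = α.rowLen u
  /-- Lattice permutation property: for each `u > 1` and each column `j`, strictly to the right
  of `j` there are at least as many entries `u - 1` as entries `u`. -/
  lattice : ∀ u, 1 < u → ∀ j,
    ((β.cells \ γ.cells).filter fun c => j < c.2 ∧ entry c = u).card ≤
      ((β.cells \ γ.cells).filter fun c => j < c.2 ∧ entry c = u - 1).card

namespace LRFilling

variable {α β γ : YoungDiagram}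

theorem entry_mono (X : LRFilling α β γ) {c d : ℕ × ℕ} (hdc : d ≤ c) (hc : c ∈ β) :
    X.entry d ≤ X.entry c := by
  obtain ⟨i, j⟩ := c
  obtain ⟨p, q⟩ := d
  obtain ⟨hp, hq⟩ : p ≤ i ∧ q ≤ j := hdc
  have hβ : ∀ {a b}, a ≤ i → b ≤ j → (a, b) ∈ β := fun h h' => β.up_left_mem h h' hc
  by_cases hd : (p, q) ∈ γ
  · rw [X.zero_off (p, q) (by simp [hd])]
    exact Nat.zero_le _
  have hγ : ∀ {a b}, p ≤ a → q ≤ b → (a, b) ∉ γ := fun h h' hn => hd (γ.up_left_mem h h' hn)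
  have hmem : ∀ {a b}, a ≤ i → b ≤ j → p ≤ a → q ≤ b → (a, b) ∈ β.cells \ γ.cells :=
    fun h1 h2 h3 h4 => by simp [hβ h1 h2, hγ h3 h4]
  have h1 : X.entry (p, q) ≤ X.entry (p, j) := by
    rcases hq.eq_or_lt with rfl | h
    · exact le_rfl
    · exact X.row_weak _ _ _ h (hmem hp hq le_rfl le_rfl) (hmem hp le_rfl le_rfl hq)
  have h2 : X.entry (p, j) ≤ X.entry (i, j) := by
    rcases hp.eq_or_lt with rfl | h
    · exact le_rfl
    · exact (X.col_strict _ _ _ h (hmem hp le_rfl le_rfl hq) (hmem le_rfl le_rfl hp hq)).le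
  exact h1.trans h2

/-- The partition `γ^(ℓ)` of the sequence `X = [γ^(0), …, γ^(s)]`: the region in `β` that
consists of the empty boxes (those of `γ`, where `entry` is `0`) and of the boxes with entry at
most `ℓ`. -/
def region (X : LRFilling α β γ) (ℓ : ℕ) : YoungDiagram where
  cells := β.cells.filter fun c => X.entry c ≤ ℓ
  isLowerSet := by
    intro c d hdc hc
    simp only [Finset.coe_filter, YoungDiagram.mem_cells, Set.mem_ofPred_eq] at hc ⊢
    exact ⟨β.up_left_mem hdc.1 hdc.2 hc.1, (X.entry_mono hdc hc.1).trans hc.2⟩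

theorem mem_region {X : LRFilling α β γ} {ℓ : ℕ} {c : ℕ × ℕ} :
    c ∈ X.region ℓ ↔ c ∈ β ∧ X.entry c ≤ ℓ := by
  rw [← YoungDiagram.mem_cells]
  simp [region]

end LRFilling

theorem DomLE.antisymm {μ ν : YoungDiagram} (h : DomLE μ ν) (h' : DomLE ν μ) : μ = ν := by
  have hs : ∀ j, ∑ i ∈ Finset.range j, μ.rowLen i = ∑ i ∈ Finset.range j, ν.rowLen i :=
    fun j => le_antisymm (h j) (h' j)
  have hr : ∀ j, μ.rowLen j = ν.rowLen j := by
    intro j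
    have h1 := hs (j + 1)
    rw [Finset.sum_range_succ, Finset.sum_range_succ, hs j] at h1
    omega
  ext ⟨i, j⟩
  rw [YoungDiagram.mem_cells, YoungDiagram.mem_cells, YoungDiagram.mem_iff_lt_rowLen,
    YoungDiagram.mem_iff_lt_rowLen, hr]

/-- The poset of LR-fillings of type `(α, β, γ)` with the dominance partial order: `Z ≤ X` iff
`δ^(ℓ) ≤ γ^(ℓ)` in the dominance order of partitions for each `ℓ`, where
`Z = [δ^(0), …, δ^(s)]` and `X = [γ^(0), …, γ^(s)]`. -/
instance (α β γ : YoungDiagram) : PartialOrder (LRFilling α β γ) where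
  le Z X := ∀ ℓ, DomLE (Z.region ℓ) (X.region ℓ)
  le_refl _ _ _ := le_rfl
  le_trans _ _ _ h h' ℓ j := (h ℓ j).trans (h' ℓ j)
  le_antisymm Z X h h' := by
    have hreg : ∀ ℓ, Z.region ℓ = X.region ℓ := fun ℓ => (h ℓ).antisymm (h' ℓ)
    ext c
    by_cases hc : c ∈ β
    · have key : ∀ ℓ, Z.entry c ≤ ℓ ↔ X.entry c ≤ ℓ := by
        intro ℓ
        have h1 : c ∈ Z.region ℓ ↔ c ∈ X.region ℓ := by rw [hreg]
        simpa [LRFilling.mem_region, hc] using h1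
      exact le_antisymm ((key _).2 le_rfl) ((key _).1 le_rfl)
    · rw [Z.zero_off c (by simp [hc]), X.zero_off c (by simp [hc])]

/-! ### Nilpotent operators -/

/-- The underlying space of `N_μ`: it has one basis vector for each box of `μ`. -/
abbrev NilSpace (k : Type*) (μ : YoungDiagram) := μ.cells → k

/-- The operator of `N_μ`: it has one Jordan block of size `μ_i` for each row `i` of `μ`. On basis
vectors, `e_(i, j+1) ↦ e_(i, j)` and `e_(i, 0) ↦ 0`. -/
def nilOp (k : Type*) [Field k] (μ : YoungDiagram) : NilSpace k μ →ₗ[k] NilSpace k μ where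
  toFun v c := if h : (c.1.1, c.1.2 + 1) ∈ μ.cells then v ⟨_, h⟩ else 0
  map_add' v w := by
    funext c
    by_cases h : (c.1.1, c.1.2 + 1) ∈ μ.cells <;> simp only [Pi.add_apply, dif_pos, dif_neg, h,
      not_false_eq_true, add_zero]
  map_smul' a v := by
    funext c
    by_cases h : (c.1.1, c.1.2 + 1) ∈ μ.cells <;> simp only [Pi.smul_apply, dif_pos, dif_neg, h,
      not_false_eq_true, smul_zero, RingHom.id_apply]

/-- The operator `(V, T)` has Jordan type `μ`: it is isomorphic to `N_μ`. -/
def HasJordanType {k V : Type*} [Field k] [AddCommGroup V] [Module k V] (T : V →ₗ[k] V)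
    (μ : YoungDiagram) : Prop :=
  ∃ e : V ≃ₗ[k] NilSpace k μ, ∀ v, e (T v) = nilOp k μ (e v)

/-- The subspace `A` is `T`-invariant and the operator induced by `T` on `V ⧸ A` has Jordan
type `μ`. -/
def QuotHasJordanType {k V : Type*} [Field k] [AddCommGroup V] [Module k V] (T : V →ₗ[k] V)
    (A : Submodule k V) (μ : YoungDiagram) : Prop :=
  ∃ h : A ≤ A.comap T, HasJordanType (A.mapQ A T h) μ

/-! ### The Zariski topology -/

/-- The Zariski topology on affine space: the closed sets are the sets of common zeros of sets of
polynomials. -/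
@[reducible]
def zariski (k : Type*) [Field k] (σ : Type*) : TopologicalSpace (σ → k) :=
  TopologicalSpace.ofClosed
    {S | ∃ P : Set (MvPolynomial σ k), S = {x | ∀ p ∈ P, MvPolynomial.eval x p = 0}}
    ⟨{1}, by ext x; simp⟩
    (by
      intro A hA
      have hA' : ∀ S ∈ A, ∃ P : Set (MvPolynomial σ k),
          S = {x | ∀ p ∈ P, MvPolynomial.eval x p = 0} := fun S hS => hA hS
      choose! P hP using hA'
      refine ⟨⋃ S ∈ A, P S, ?_⟩
      ext x
      simp only [Set.mem_sInter, Set.mem_iUnion, Set.mem_ofPred_eq, forall_exists_index]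
      constructor
      · intro h p S hS hp
        have h1 := h S hS
        rw [hP S hS] at h1
        exact h1 p hp
      · intro h S hS
        rw [hP S hS]
        exact fun p hp => h p S hS hp)
    (by
      rintro _ ⟨P, rfl⟩ _ ⟨Q, rfl⟩
      refine ⟨{r | ∃ p ∈ P, ∃ q ∈ Q, r = p * q}, ?_⟩
      ext x
      simp only [Set.mem_union, Set.mem_ofPred_eq]
      constructor
      · rintro (h | h) r ⟨p, hp, q, hq, rfl⟩
        · rw [map_mul, h p hp, zero_mul]
        · rw [map_mul, h q hq, mul_zero]
      · intro h
        by_contra hn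
        push Not at hn
        obtain ⟨⟨p, hp, hp0⟩, ⟨q, hq, hq0⟩⟩ := hn
        have h1 := h _ ⟨p, hp, q, hq, rfl⟩
        rw [map_mul] at h1
        exact (mul_ne_zero hp0 hq0) h1)

/-- The Zariski topology on the affine space `Hom_k(N_α, N_β)`, by means of matrix entries. -/
@[reducible]
noncomputable def homZariski (k : Type*) [Field k] (α β : YoungDiagram) :
    TopologicalSpace (NilSpace k α →ₗ[k] NilSpace k β) :=
  TopologicalSpace.induced
    (fun f => fun p : β.cells × α.cells => LinearMap.toMatrix' f p.1 p.2)
    (zariski k (β.cells × α.cells))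

/-! ### The variety of short exact sequences and its decomposition -/

/-- `𝕍_{α,γ}^β`: the `k[T]`-monomorphisms `f : N_α → N_β` with cokernel isomorphic to `N_γ`. -/
def SESVariety (k : Type*) [Field k] (α β γ : YoungDiagram) : Type _ :=
  {f : NilSpace k α →ₗ[k] NilSpace k β // (∀ v, f (nilOp k α v) = nilOp k β (f v)) ∧
    Function.Injective f ∧ QuotHasJordanType (nilOp k β) (LinearMap.range f) γ}

/-- `𝕍_{α,γ}^β` carries the subspace topology of the Zariski topology on `Hom_k(N_α, N_β)`. -/
noncomputable instance (k : Type*) [Field k] (α β γ : YoungDiagram) :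
    TopologicalSpace (SESVariety k α β γ) :=
  TopologicalSpace.induced Subtype.val (homZariski k α β)

/-- `𝕍_X`: the embeddings with tableau `X = [γ^(0), …, γ^(s)]`, that is, `T` acts on `B ⧸ T^ℓ A`
with Jordan type the transpose of `γ^(ℓ)` for each `ℓ`, where `B = N_β` and `A` is the image of
`N_α`. The tableaux of embeddings in `𝕍_{α,γ}^β` have type `(α', β', γ')`. -/
def component (k : Type*) [Field k] {α β γ : YoungDiagram}
    (X : LRFilling α.transpose β.transpose γ.transpose) : Set (SESVariety k α β γ) :=
  {f | ∀ ℓ : ℕ, QuotHasJordanType (nilOp k β)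
    ((LinearMap.range f.1).map (nilOp k β ^ ℓ)) (X.region ℓ).transpose}

end LRVar

/-! Since the strip is a rook strip, each row and each column of `β' ∖ γ'` holds at most one box,
and the boxes move strictly left from row to row. A filling is therefore a word on the set `P` of
occupied rows, subject only to the content and the lattice condition (`LRFilling.isLatticeWord`,
`LRFilling.ofWord`). Passing from `β'` to the region of level `ℓ` removes the boxes with letter
above `ℓ`, so `X ≤ Z` says that every prefix of the word of `X` has at least as many letters above
`ℓ` as that of `Z`, for all `ℓ` (`LRFilling.le_iff`).

For an embedding with image `A` in `B = N_β`, let `r(j, ℓ)` be the dimension of the image of `T^ℓ A`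
in `B / T^j B`. These numbers encode the Jordan types of all `B / T^ℓ A` (`quotHasJordanType_iff`),
and `𝕍_X` is the locus where `r(j, ℓ)` counts the letters above `ℓ` at positions before `j` in the
word of `X` (`mem_component_iff`). Monotonicity and convexity of `r` force it to come from some
lattice word (`exists_isLatticeWord_of_rank`), whence the covering; the counts determine the
filling, whence disjointness.

Ranks are lower semicontinuous (`isOpen_le_homRank`), so a minimal filling gives an open component
and a maximal one a closed component. Conversely, let `X` arise from `Z` by exchanging two adjacent
letters in increasing order, with the lattice property preserved. Then `X < Z`, and an explicit
deformation of the standard embedding of `Z` is an affine line that lies in `𝕍_X` except for one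
point in `𝕍_Z` (`IsExchange.exists_line`). Hence `𝕍_X` is not closed and `𝕍_Z` is not open.

Uniqueness of the extremes comes from the same exchanges. Attach to each occurrence of a letter its
index, the number of earlier equal letters; all lattice words of one content carry the same set of
pairs (letter, index). A word with no admissible ascent lists the pairs (index, letter)
lexicographically, and a word with no descent lists (letter, index) lexicographically, so each kind
is unique (`IsLatticeWord.eqOn_of_no_ascent`, `IsLatticeWord.eqOn_of_no_descent`). Every filling
other than `O` is thus the upper end of an exchange, and every filling other than `C` the lower end
of one. -/

namespace LRVar

open Module

/-! ### Coordinates on nilpotent spaces -/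

section Coordinates

variable {k : Type*} [Field k] {μ ν : YoungDiagram}

/-- Coordinates of a vector of `N_μ`, extended by zero to all boxes. -/
def coord (v : NilSpace k μ) (c : ℕ × ℕ) : k :=
  if h : c ∈ μ.cells then v ⟨c, h⟩ else 0

theorem coord_coe (v : NilSpace k μ) (c : μ.cells) : coord v c = v c := by
  simp [coord]

theorem coord_of_notMem (v : NilSpace k μ) {c : ℕ × ℕ} (h : c ∉ μ) : coord v c = 0 :=
  dif_neg (by simpa using h)

theorem coord_add (v w : NilSpace k μ) (c : ℕ × ℕ) : coord (v + w) c = coord v c + coord w c := by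
  unfold coord; split <;> simp

theorem coord_smul (a : k) (v : NilSpace k μ) (c : ℕ × ℕ) : coord (a • v) c = a * coord v c := by
  unfold coord; split <;> simp

theorem ext_coord {v w : NilSpace k μ} (h : ∀ c, coord v c = coord w c) : v = w := by
  funext c
  rw [← coord_coe v, ← coord_coe w, h]

theorem coord_nilOp (v : NilSpace k μ) (i j : ℕ) : coord (nilOp k μ v) (i, j) = coord v (i, j + 1) := by
  by_cases h : (i, j) ∈ μ.cells
  · simp [coord, nilOp, h]
  · have h' : (i, j + 1) ∉ μ.cells := fun h' =>
      h (by simpa using μ.up_left_mem le_rfl (Nat.le_succ j) (by simpa using h'))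
    simp [coord, h, h']

theorem coord_nilOp_pow (ℓ : ℕ) (v : NilSpace k μ) (i j : ℕ) :
    coord ((nilOp k μ ^ ℓ) v) (i, j) = coord v (i, j + ℓ) := by
  induction ℓ generalizing j with
  | zero => rfl
  | succ ℓ ih => rw [pow_succ', Module.End.mul_apply, coord_nilOp, ih, add_right_comm, add_assoc]

theorem lt_rowLen_zero {i j : ℕ} (h : (i, j) ∈ μ) : j < μ.rowLen 0 :=
  YoungDiagram.mem_iff_lt_rowLen.1 (μ.up_left_mem (Nat.zero_le i) le_rfl h)

theorem nilOp_pow_eq_zero {ℓ : ℕ} (h : μ.rowLen 0 ≤ ℓ) : nilOp k μ ^ ℓ = 0 := by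
  refine LinearMap.ext fun v => ext_coord fun ⟨i, j⟩ => ?_
  rw [coord_nilOp_pow, coord_of_notMem, LinearMap.zero_apply]
  · unfold coord; split <;> rfl
  · intro h'
    have := lt_rowLen_zero h'
    omega

theorem isNilpotent_nilOp : IsNilpotent (nilOp k μ) := ⟨_, nilOp_pow_eq_zero le_rfl⟩

theorem finrank_vanishing {ι : Type*} [Fintype ι] (S : Finset ι) (U : Submodule k (ι → k))
    (hU : ∀ v, v ∈ U ↔ ∀ c ∉ S, v c = 0) : finrank k U = S.card := by
  let L : U →ₗ[k] (S → k) := (LinearMap.funLeft k k (Subtype.val : S → ι)).comp U.subtype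
  have hL : ∀ (v : U) (c : S), L v c = v.1 c := fun _ _ => rfl
  have hb : Function.Bijective L := by
    classical
    constructor
    · rw [injective_iff_map_eq_zero]
      intro v hv
      ext c
      by_cases hc : c ∈ S
      · simpa [hL] using congrFun hv ⟨c, hc⟩
      · exact (hU _).1 v.2 c hc
    · intro y
      refine ⟨⟨fun c => if h : c ∈ S then y ⟨c, h⟩ else 0, (hU _).2 fun c hc => dif_neg hc⟩, ?_⟩
      ext c
      simp [hL]
  rw [(LinearEquiv.ofBijective L hb).finrank_eq, finrank_fintype_fun_eq_card, Fintype.card_coe]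

theorem mem_ker_nilOp_pow {j : ℕ} {v : NilSpace k μ} :
    v ∈ LinearMap.ker (nilOp k μ ^ j) ↔ ∀ c, j ≤ c.2 → coord v c = 0 := by
  rw [LinearMap.mem_ker]
  constructor
  · rintro h ⟨i, m⟩ hm
    obtain ⟨m, rfl⟩ := Nat.exists_eq_add_of_le' hm
    rw [← coord_nilOp_pow, h]
    unfold coord; split <;> rfl
  · intro h
    refine ext_coord fun ⟨i, m⟩ => ?_
    rw [coord_nilOp_pow, h _ (Nat.le_add_left _ _)]
    unfold coord; split <;> rfl

theorem card_cells_col_lt (μ : YoungDiagram) (j : ℕ) :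
    (μ.cells.filter fun c => c.2 < j).card = ∑ q ∈ Finset.range j, μ.colLen q := by
  rw [Finset.card_eq_sum_card_fiberwise (f := Prod.snd) (t := Finset.range j)]
  · refine Finset.sum_congr rfl fun q hq => ?_
    rw [YoungDiagram.colLen_eq_card]
    congr 1
    ext c
    simp only [Finset.mem_filter, YoungDiagram.mem_cells, YoungDiagram.mem_col_iff]
    simp only [Finset.mem_range] at hq
    constructor
    · rintro ⟨⟨h, -⟩, h'⟩
      exact ⟨h, h'⟩
    · rintro ⟨h, rfl⟩
      exact ⟨⟨h, hq⟩, rfl⟩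
  · intro c hc
    simpa using (Finset.mem_filter.1 hc).2

theorem finrank_ker_nilOp_pow (j : ℕ) :
    finrank k (LinearMap.ker (nilOp k μ ^ j)) = ∑ q ∈ Finset.range j, μ.colLen q := by
  rw [← card_cells_col_lt, finrank_vanishing (Finset.univ.filter fun c : μ.cells => c.1.2 < j)]
  · refine Finset.card_bij (fun c _ => c.1) (fun c hc => ?_) (fun _ _ _ _ h => Subtype.ext h)
      fun c hc => ?_
    · simpa using hc
    · simp only [Finset.mem_filter] at hc
      exact ⟨⟨c, hc.1⟩, by simpa using hc.2, rfl⟩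
  · intro v
    rw [mem_ker_nilOp_pow]
    constructor
    · intro h c hc
      rw [← coord_coe v]
      exact h _ (by simpa using hc)
    · intro h c hc
      by_cases hm : c ∈ μ.cells
      · simpa [coord, hm] using h ⟨c, hm⟩ (by simpa using hc)
      · exact coord_of_notMem _ (by simpa using hm)

end Coordinates

/-! ### Jordan types -/

section Jordan

variable {k V : Type*} [Field k] [AddCommGroup V] [Module k V] {T : V →ₗ[k] V}
  {μ ν : YoungDiagram}

theorem HasJordanType.pow_apply {e : V ≃ₗ[k] NilSpace k μ}
    (he : ∀ v, e (T v) = nilOp k μ (e v)) (j : ℕ) (v : V) :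
    e ((T ^ j) v) = (nilOp k μ ^ j) (e v) := by
  induction j generalizing v with
  | zero => rfl
  | succ j ih => rw [pow_succ, pow_succ, Module.End.mul_apply, Module.End.mul_apply, ih, he]

theorem HasJordanType.finrank_ker_pow (h : HasJordanType T μ) (j : ℕ) :
    finrank k (LinearMap.ker (T ^ j)) = ∑ q ∈ Finset.range j, μ.colLen q := by
  obtain ⟨e, he⟩ := h
  rw [← finrank_ker_nilOp_pow (k := k)]
  have : (LinearMap.ker (T ^ j)).map (e : V →ₗ[k] NilSpace k μ) =
      LinearMap.ker (nilOp k μ ^ j) := by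
    ext w
    simp only [Submodule.mem_map, LinearMap.mem_ker, LinearEquiv.coe_coe]
    constructor
    · rintro ⟨v, hv, rfl⟩
      rw [← HasJordanType.pow_apply he, hv, map_zero]
    · intro hw
      refine ⟨e.symm w, e.injective ?_, e.apply_symm_apply w⟩
      rw [HasJordanType.pow_apply he, e.apply_symm_apply, hw, map_zero]
  rw [← this, LinearEquiv.finrank_map_eq]

theorem eq_of_sum_colLen_eq
    (h : ∀ j, ∑ q ∈ Finset.range j, μ.colLen q = ∑ q ∈ Finset.range j, ν.colLen q) : μ = ν := by
  have hr : ∀ j, μ.colLen j = ν.colLen j := by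
    intro j
    have h1 := h (j + 1)
    rw [Finset.sum_range_succ, Finset.sum_range_succ, h j] at h1
    omega
  ext ⟨i, j⟩
  rw [YoungDiagram.mem_cells, YoungDiagram.mem_cells, YoungDiagram.mem_iff_lt_colLen,
    YoungDiagram.mem_iff_lt_colLen, hr]

/-- The diagram with first row `n` and remaining rows those of `μ`. -/
def consRow (n : ℕ) (μ : YoungDiagram) (h : μ.rowLen 0 ≤ n) : YoungDiagram where
  cells := (Finset.range n).image (fun j => (0, j)) ∪ μ.cells.image fun c => (c.1 + 1, c.2)
  isLowerSet := by
    rintro ⟨i, j⟩ ⟨p, q⟩ ⟨hp : p ≤ i, hq : q ≤ j⟩ hc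
    simp only [Finset.coe_union, Finset.coe_image, Set.mem_union, Set.mem_image, Finset.mem_coe,
      Finset.mem_range, YoungDiagram.mem_cells, Prod.mk.injEq, Prod.exists] at hc ⊢
    have hj : j < n := by
      rcases hc with ⟨a, ha, -, rfl⟩ | ⟨a, b, hab, -, rfl⟩
      · exact ha
      · exact (lt_rowLen_zero hab).trans_le h
    rcases p with _ | p
    · exact Or.inl ⟨q, hq.trans_lt hj, rfl, rfl⟩
    · rcases hc with ⟨a, ha, rfl, rfl⟩ | ⟨a, b, hab, rfl, rfl⟩
      · omega
      · exact Or.inr ⟨p, q, μ.up_left_mem (by omega) hq hab, rfl, rfl⟩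

theorem zero_mem_consRow {n : ℕ} {h : μ.rowLen 0 ≤ n} {j : ℕ} :
    (0, j) ∈ consRow n μ h ↔ j < n := by
  rw [← YoungDiagram.mem_cells]
  simp [consRow]

theorem succ_mem_consRow {n : ℕ} {h : μ.rowLen 0 ≤ n} {i j : ℕ} :
    (i + 1, j) ∈ consRow n μ h ↔ (i, j) ∈ μ := by
  rw [← YoungDiagram.mem_cells]
  simp [consRow]

theorem rowLen_consRow_zero {n : ℕ} (h : μ.rowLen 0 ≤ n) : (consRow n μ h).rowLen 0 = n := by
  have : ∀ j, j < (consRow n μ h).rowLen 0 ↔ j < n := fun j => by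
    rw [← YoungDiagram.mem_iff_lt_rowLen, zero_mem_consRow]
  have h1 := this n
  have h2 := this ((consRow n μ h).rowLen 0)
  omega

/-- A cyclic vector of maximal order splits off. -/
theorem exists_dual_chain {n : ℕ} {u : V} (hT : T ^ (n + 1) = 0) (hu : (T ^ n) u ≠ 0) :
    ∃ φ : V →ₗ[k] k, ∀ i, φ ((T ^ i) u) = if i = n then 1 else 0 := by
  have hnot : (T ^ n) u ∉ Submodule.span k ((fun i => (T ^ i) u) '' Set.Iio n) := by
    intro hmem
    -- The vectors `T^i u` are added in decreasing order of `i`. Applying `T^(m+1)` to a relation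
    -- kills everything except the newest term, which becomes a multiple of `T^n u`, so its
    -- coefficient vanishes.
    have key : ∀ m ≤ n, (T ^ n) u ∉ Submodule.span k ((fun i => (T ^ i) u) '' Set.Ico (n - m) n) := by
      intro m
      induction m with
      | zero => simpa using hu
      | succ m ih =>
        intro hm hmem
        have hI : Set.Ico (n - (m + 1)) n = insert (n - (m + 1)) (Set.Ico (n - m) n) := by
          ext x; simp only [Set.mem_Ico, Set.mem_insert_iff]; omega
        rw [hI, Set.image_insert_eq, Submodule.mem_span_insert] at hmem
        obtain ⟨a, z, hz, h⟩ := hmem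
        have hz0 : (T ^ (m + 1)) z = 0 := by
          refine (Submodule.span_le (p := LinearMap.ker (T ^ (m + 1)))).2 ?_ hz
          rintro _ ⟨i, hi, rfl⟩
          simp only [Set.mem_Ico] at hi
          change (T ^ (m + 1)) ((T ^ i) u) = 0
          rw [← Module.End.mul_apply, ← pow_add, show m + 1 + i = (m + i - n) + (n + 1) by omega,
            pow_add, hT, mul_zero, LinearMap.zero_apply]
        have h1 := congrArg (T ^ (m + 1)) h
        rw [map_add, hz0, map_smul, ← Module.End.mul_apply, ← Module.End.mul_apply, ← pow_add,
          ← pow_add, show m + 1 + (n - (m + 1)) = n by omega,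
          show m + 1 + n = m + (n + 1) by omega, pow_add, hT, mul_zero, LinearMap.zero_apply,
          add_zero, eq_comm, smul_eq_zero, or_iff_left hu] at h1
        rw [h1, zero_smul, zero_add] at h
        exact ih (by omega) (h ▸ hz)
    refine key n le_rfl ?_
    convert hmem using 3
    ext; simp
  obtain ⟨ψ, hψ, hle⟩ := Submodule.exists_le_ker_of_notMem hnot
  refine ⟨(ψ ((T ^ n) u))⁻¹ • ψ, fun i => ?_⟩
  rcases lt_trichotomy i n with h | rfl | h
  · have : ψ ((T ^ i) u) = 0 := hle (Submodule.subset_span ⟨i, h, rfl⟩)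
    simp [this, h.ne]
  · simp [hψ]
  · rw [if_neg h.ne', show i = (i - n - 1) + (n + 1) by omega, pow_add, hT, mul_zero,
      LinearMap.zero_apply, map_zero]

end Jordan

section Jordan

variable {k : Type*} [Field k] {μ ν : YoungDiagram}

/-- The chain `u, T u, …, T^m u` spans one Jordan block. The largest `T`-stable subspace `W` in the
kernel of the dual functional `φ` is a complement, and `v - S (Ψ v)` is the projection to it; it
commutes with `T`. -/
theorem hasJordanType_consRow {V : Type*} [AddCommGroup V] [Module k V] {T : V →ₗ[k] V} {m : ℕ}
    (hT : T ^ (m + 1) = 0) {u : V} {φ : V →ₗ[k] k}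
    (hφ : ∀ i, φ ((T ^ i) u) = if i = m then 1 else 0) {W : Submodule k V}
    (hW : ∀ w, w ∈ W ↔ ∀ i, φ ((T ^ i) w) = 0) (hTW : ∀ w ∈ W, T w ∈ W)
    (hμ : μ.rowLen 0 ≤ m + 1) (h : HasJordanType (T.restrict hTW) μ) :
    HasJordanType T (consRow (m + 1) μ hμ) := by
  obtain ⟨e, he⟩ := h
  -- The exponent `m - j` makes the coordinates `φ ∘ T^i` dual to these chain vectors.
  let S : (ℕ → k) →ₗ[k] V :=
    ∑ j ∈ Finset.range (m + 1), (LinearMap.proj j : (ℕ → k) →ₗ[k] k).smulRight ((T ^ (m - j)) u)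
  have hSdef : ∀ y, S y = ∑ j ∈ Finset.range (m + 1), y j • (T ^ (m - j)) u := fun y => by
    simp [S]
  have hTpow : ∀ i, m < i → ∀ v, (T ^ i) v = 0 := fun i hi v => by
    rw [show i = (i - m - 1) + (m + 1) by omega, pow_add, hT, mul_zero, LinearMap.zero_apply]
  have hS : ∀ y i, i ≤ m → φ ((T ^ i) (S y)) = y i := by
    intro y i hi
    rw [hSdef, map_sum, map_sum, Finset.sum_eq_single i]
    · rw [map_smul, map_smul, ← Module.End.mul_apply, ← pow_add, hφ, if_pos (by omega),
        smul_eq_mul, mul_one]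
    · intro j hj hji
      have := Finset.mem_range.1 hj
      rw [map_smul, map_smul, ← Module.End.mul_apply, ← pow_add, hφ, if_neg (by omega),
        smul_zero]
    · intro h
      exact absurd (Finset.mem_range.2 (by omega)) h
  let Ψ : V →ₗ[k] (ℕ → k) := LinearMap.pi fun j => φ.comp (T ^ j)
  have hΨ : ∀ v j, Ψ v j = φ ((T ^ j) v) := fun _ _ => rfl
  let P : V →ₗ[k] V := LinearMap.id - S.comp Ψ
  have hP : ∀ v, P v = v - S (Ψ v) := fun _ => rfl
  have hPW : ∀ v, P v ∈ W := by
    intro v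
    rw [hW]
    intro i
    rcases le_or_gt i m with hi | hi
    · rw [hP, map_sub, map_sub, hS _ _ hi, hΨ, sub_self]
    · rw [hTpow i hi, map_zero]
  have hPT : ∀ v, P (T v) = T (P v) := by
    intro v
    rw [hP, hP, map_sub]
    congr 1
    rw [hSdef, hSdef, map_sum, Finset.sum_range_succ, Finset.sum_range_succ']
    congr 1
    · refine Finset.sum_congr rfl fun j hj => ?_
      have := Finset.mem_range.1 hj
      rw [map_smul, ← Module.End.mul_apply, ← pow_succ', hΨ, hΨ, ← Module.End.mul_apply,
        ← pow_succ, show m - (j + 1) + 1 = m - j by omega]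
    · rw [map_smul, ← Module.End.mul_apply, ← pow_succ', hTpow (m - 0 + 1) (by omega), hΨ,
        ← Module.End.mul_apply, ← pow_succ, hTpow (m + 1) (by omega), map_zero, zero_smul, smul_zero]
  let Q : V →ₗ[k] W := P.codRestrict W hPW
  have hQT : ∀ v, Q (T v) = T.restrict hTW (Q v) := fun v => Subtype.ext (hPT v)
  let E : V →ₗ[k] NilSpace k (consRow (m + 1) μ hμ) :=
    { toFun := fun v c => if c.1.1 = 0 then φ ((T ^ c.1.2) v)
        else coord (e (Q v)) (c.1.1 - 1, c.1.2)
      map_add' := fun v w => by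
        funext c
        by_cases hc : c.1.1 = 0 <;> simp [hc, coord_add]
      map_smul' := fun a v => by
        funext c
        by_cases hc : c.1.1 = 0 <;> simp [hc, coord_smul] }
  have hE0 : ∀ v j, coord (E v) (0, j) = φ ((T ^ j) v) := by
    intro v j
    by_cases hj : j < m + 1
    · have hm : (0, j) ∈ (consRow (m + 1) μ hμ).cells := zero_mem_consRow.2 hj
      simp [coord, hm, E]
    · rw [coord_of_notMem _ (by rwa [zero_mem_consRow]), hTpow j (by omega), map_zero]
  have hE1 : ∀ v i j, coord (E v) (i + 1, j) = coord (e (Q v)) (i, j) := by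
    intro v i j
    by_cases hj : (i, j) ∈ μ
    · have hm : (i + 1, j) ∈ (consRow (m + 1) μ hμ).cells := succ_mem_consRow.2 hj
      rw [coord, dif_pos hm]
      simp [E]
    · rw [coord_of_notMem _ (by rwa [succ_mem_consRow]), coord_of_notMem _ hj]
  have hb : Function.Bijective E := by
    constructor
    · rw [injective_iff_map_eq_zero]
      intro v hv
      have hz : ∀ {ν : YoungDiagram} c, coord (0 : NilSpace k ν) c = 0 := fun c => by
        unfold coord; split <;> rfl
      have hΨ0 : Ψ v = 0 := by
        funext j
        rw [hΨ, ← hE0, hv, hz]; rfl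
      have hQ0 : Q v = 0 := by
        rw [← e.map_eq_zero_iff]
        refine ext_coord fun ⟨i, j⟩ => ?_
        rw [← hE1, hv, hz, hz]
      have : P v = 0 := congrArg Subtype.val hQ0
      rwa [hP, hΨ0, map_zero, sub_zero] at this
    · intro y
      let w : W := e.symm fun c => coord y (c.1.1 + 1, c.1.2)
      let v : V := S (fun j => coord y (0, j)) + w
      have hw : ∀ i, φ ((T ^ i) w.1) = 0 := (hW _).1 w.2
      have hv : ∀ i ≤ m, φ ((T ^ i) v) = coord y (0, i) := fun i hi => by
        rw [map_add, map_add, hS _ _ hi, hw, add_zero]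
      have hSv : S (Ψ v) = S (fun j => coord y (0, j)) := by
        rw [hSdef, hSdef]
        refine Finset.sum_congr rfl fun j hj => ?_
        rw [hΨ, hv j (by simpa [Nat.lt_succ_iff] using hj)]
      have hQv : Q v = w := by
        apply Subtype.ext
        change P v = w
        rw [hP, hSv, add_sub_cancel_left]
      refine ⟨v, ext_coord fun ⟨i, j⟩ => ?_⟩
      rcases i with _ | i
      · rw [hE0]
        rcases le_or_gt j m with hj | hj
        · exact hv j hj
        · rw [hTpow j hj, map_zero, coord_of_notMem]
          rw [zero_mem_consRow]; omega
      · rw [hE1, hQv]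
        by_cases hm : (i, j) ∈ μ.cells
        · simp [w, coord, hm]
        · have h1 : (i, j) ∉ μ := by simpa using hm
          rw [coord_of_notMem _ h1, coord_of_notMem _ (by rwa [succ_mem_consRow])]
  refine ⟨LinearEquiv.ofBijective E hb, fun v => ext_coord fun ⟨i, j⟩ => ?_⟩
  simp only [LinearEquiv.ofBijective_apply]
  rw [coord_nilOp]
  rcases i with _ | i
  · rw [hE0, hE0, pow_succ, Module.End.mul_apply]
  · rw [hE1, hE1, hQT, he, coord_nilOp]

/-- Induction on the dimension, splitting off a block whose size is the nilpotency index. The bound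
on the first row is carried along because it lets the new, longest row be placed on top. -/
theorem exists_hasJordanType {V : Type*} [AddCommGroup V] [Module k V] [FiniteDimensional k V]
    {T : V →ₗ[k] V} {n : ℕ} (hT : T ^ n = 0) : ∃ μ : YoungDiagram, μ.rowLen 0 ≤ n ∧
      HasJordanType T μ := by
  induction hd : finrank k V using Nat.strong_induction_on generalizing V n with
  | _ d ih =>
  rcases subsingleton_or_nontrivial V with hV | hV
  · have hbot : ∀ i, (⊥ : YoungDiagram).rowLen i = 0 := fun i => by
      by_contra h
      exact YoungDiagram.notMem_bot (i, 0)
        (YoungDiagram.mem_iff_lt_rowLen.2 (Nat.pos_of_ne_zero h))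
    have : IsEmpty (⊥ : YoungDiagram).cells :=
      ⟨fun c => YoungDiagram.notMem_bot c.1 ((YoungDiagram.mem_cells _).1 c.2)⟩
    exact ⟨⊥, by simp [hbot], ⟨0, fun v => Subsingleton.elim _ _⟩⟩
  · classical
    have hex : ∃ n, T ^ n = 0 := ⟨n, hT⟩
    obtain ⟨m, hm⟩ : ∃ m, Nat.find hex = m + 1 := by
      refine Nat.exists_eq_succ_of_ne_zero fun h0 => ?_
      have := Nat.find_spec hex
      rw [h0, pow_zero] at this
      exact one_ne_zero this
    have hTm : T ^ (m + 1) = 0 := hm ▸ Nat.find_spec hex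
    have hmn : m + 1 ≤ n := hm ▸ Nat.find_min' hex hT
    obtain ⟨u, hu⟩ : ∃ u, (T ^ m) u ≠ 0 := by
      by_contra! h
      exact Nat.find_min hex (by omega : m < _) (LinearMap.ext h)
    obtain ⟨φ, hφ⟩ := exists_dual_chain hTm hu
    let W : Submodule k V := ⨅ i, LinearMap.ker (φ.comp (T ^ i))
    have hW : ∀ w, w ∈ W ↔ ∀ i, φ ((T ^ i) w) = 0 := fun w => by
      simp [W, Submodule.mem_iInf]
    have hTW : ∀ w ∈ W, T w ∈ W := fun w hw => by
      rw [hW] at hw ⊢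
      intro i
      rw [← Module.End.mul_apply, ← pow_succ]
      exact hw _
    have hlt : finrank k W < d := by
      rw [← hd]
      refine Submodule.finrank_lt fun htop => ?_
      have := (hW ((T ^ m) u)).1 (htop ▸ Submodule.mem_top) 0
      rw [pow_zero, Module.End.one_apply, hφ, if_pos rfl] at this
      exact one_ne_zero this
    obtain ⟨μ, hμ, h⟩ := ih _ hlt (T := T.restrict hTW) (n := m + 1) (by
      rw [Module.End.pow_restrict]
      ext w
      simp [hTm]) rfl
    exact ⟨consRow (m + 1) μ hμ, (rowLen_consRow_zero hμ).trans_le hmn,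
      hasJordanType_consRow hTm hφ hW hTW hμ h⟩

/-- The Jordan type of a nilpotent operator is determined by the kernels of its powers. -/
theorem hasJordanType_iff {V : Type*} [AddCommGroup V] [Module k V] [FiniteDimensional k V]
    {T : V →ₗ[k] V} (hT : IsNilpotent T) : HasJordanType T μ ↔
      ∀ j, finrank k (LinearMap.ker (T ^ j)) = ∑ q ∈ Finset.range j, μ.colLen q := by
  refine ⟨HasJordanType.finrank_ker_pow, fun h => ?_⟩
  obtain ⟨n, hn⟩ := hT
  obtain ⟨ν, -, hν⟩ := exists_hasJordanType hn
  have : ν = μ := eq_of_sum_colLen_eq fun j => by rw [← hν.finrank_ker_pow, h]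
  exact this ▸ hν

end Jordan

/-! ### Lattice words -/

/-- The number of positions `q ∈ P` before `j` whose letter satisfies `A`. -/
def cnt (P : Finset ℕ) (w : ℕ → ℕ) (A : ℕ → Prop) [DecidablePred A] (j : ℕ) : ℕ :=
  Nat.count (fun q => q ∈ P ∧ A (w q)) j

/-- Lattice words on the set of positions `P` with `a u` letters `u + 1`. -/
structure IsLatticeWord (P : Finset ℕ) (a w : ℕ → ℕ) : Prop where
  pos : ∀ p ∈ P, 0 < w p
  content : ∀ u, (P.filter fun p => w p = u + 1).card = a u
  lattice : ∀ u, 0 < u → ∀ j, cnt P w (· = u + 1) j ≤ cnt P w (· = u) j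

/-- The number of earlier occurrences of the letter at position `p`. -/
def chainIdx (P : Finset ℕ) (w : ℕ → ℕ) (p : ℕ) : ℕ := cnt P w (· = w p) p

section Words

variable {P : Finset ℕ} {a w w' : ℕ → ℕ} {A : ℕ → Prop} [DecidablePred A]

theorem cnt_succ (j : ℕ) : cnt P w A (j + 1) = cnt P w A j + if j ∈ P ∧ A (w j) then 1 else 0 :=
  Nat.count_succ _ _

theorem cnt_mono {i j : ℕ} (h : i ≤ j) : cnt P w A i ≤ cnt P w A j := Nat.count_monotone _ h

theorem cnt_congr {j : ℕ} (h : ∀ q ∈ P, q < j → w q = w' q) : cnt P w A j = cnt P w' A j := by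
  induction j with
  | zero => rfl
  | succ j ih =>
    rw [cnt_succ, cnt_succ, ih fun q hq hj => h q hq (by omega)]
    by_cases hj : j ∈ P
    · rw [h j hj (Nat.lt_succ_self j)]
    · simp [hj]

theorem cnt_eq_card (j : ℕ) : cnt P w A j = (P.filter fun q => q < j ∧ A (w q)).card := by
  rw [cnt, Nat.count_eq_card_filter_range]
  congr 1
  ext q
  simp only [Finset.mem_filter, Finset.mem_range]
  tauto

theorem cnt_of_forall_lt {j : ℕ} (h : ∀ q ∈ P, q < j) :
    cnt P w A j = (P.filter fun q => A (w q)).card := by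
  rw [cnt_eq_card]
  congr 1
  ext q
  simp only [Finset.mem_filter]
  exact ⟨fun h' => ⟨h'.1, h'.2.2⟩, fun h' => ⟨h'.1, h q h'.1, h'.2⟩⟩

/-- The count climbs by at most one per step, so it takes the value `i` just before some occurrence.
-/
theorem exists_of_lt_cnt {i j : ℕ} (h : i < cnt P w A j) :
    ∃ q ∈ P, q < j ∧ A (w q) ∧ cnt P w A q = i := by
  induction j with
  | zero => simp [cnt] at h
  | succ j ih =>
    by_cases hj : i < cnt P w A j
    · obtain ⟨q, hq, hlt, h1⟩ := ih hj
      exact ⟨q, hq, by omega, h1⟩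
    · rw [cnt_succ] at h
      split_ifs at h with hc
      · exact ⟨j, hc.1, Nat.lt_succ_self j, hc.2, by omega⟩
      · omega

theorem lt_add_sup {p : ℕ} (hp : p ∈ P) : p < P.sup id + 1 :=
  Nat.lt_succ_of_le (Finset.le_sup (f := id) hp)

theorem eq_of_chainIdx_eq {p q : ℕ} (hp : p ∈ P) (hq : q ∈ P) (hw : w p = w q)
    (h : chainIdx P w p = chainIdx P w q) : p = q := by
  unfold chainIdx at h
  simp only [hw] at h
  exact Nat.count_injective (p := fun r => r ∈ P ∧ w r = w q) ⟨hp, hw⟩ ⟨hq, rfl⟩ h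

theorem chainIdx_lt {p q : ℕ} (hp : p ∈ P) (hpq : p < q) (hw : w p = w q) :
    chainIdx P w p < chainIdx P w q := by
  unfold chainIdx
  simp only [hw]
  exact Nat.count_strict_mono (p := fun r => r ∈ P ∧ w r = w q) ⟨hp, hw⟩ hpq

namespace IsLatticeWord

theorem chainIdx_lt_content (h : IsLatticeWord P a w) {p : ℕ} (hp : p ∈ P) :
    chainIdx P w p < a (w p - 1) := by
  have hpos := h.pos p hp
  have h1 := h.content (w p - 1)
  rw [Nat.sub_add_cancel hpos] at h1
  rw [← h1, ← cnt_of_forall_lt (A := (· = w p)) fun q hq => lt_add_sup hq]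
  refine lt_of_lt_of_le ?_ (cnt_mono (show p + 1 ≤ _ from lt_add_sup hp))
  rw [cnt_succ]
  simp [hp, chainIdx]

theorem exists_of_lt_content (h : IsLatticeWord P a w) {u i : ℕ} (hi : i < a u) :
    ∃ p ∈ P, w p = u + 1 ∧ chainIdx P w p = i := by
  rw [← h.content u, ← cnt_of_forall_lt (A := (· = u + 1)) fun q hq => lt_add_sup hq] at hi
  obtain ⟨p, hp, -, hw, hc⟩ := exists_of_lt_cnt hi
  exact ⟨p, hp, hw, by simpa [chainIdx, hw] using hc⟩

/-- Just past an occurrence of `u + 1` with index `i`, the lattice condition demands more than `i`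
letters `u`, so the letter `u` of index `i` stands strictly earlier. Letters of equal index thus
form a chain in which `1, 2, 3, …` occur at increasing positions. -/
theorem exists_chain (h : IsLatticeWord P a w) {p : ℕ} (hp : p ∈ P) :
    ∀ m, m < w p → ∃ q ∈ P, w q + m = w p ∧ chainIdx P w q = chainIdx P w p ∧ q + m ≤ p := by
  intro m
  induction m with
  | zero => exact fun _ => ⟨p, hp, rfl, rfl, le_rfl⟩
  | succ m ih =>
    intro hm
    obtain ⟨q, hq, hw, hc, hle⟩ := ih (by omega)
    obtain ⟨u, hu⟩ : ∃ u, w q = u + 1 := ⟨w q - 1, by omega⟩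
    have h1 := h.lattice u (by omega) (q + 1)
    rw [cnt_succ, cnt_succ, if_pos ⟨hq, hu⟩, if_neg (by omega)] at h1
    have h2 : chainIdx P w q = cnt P w (· = u + 1) q := by simp [chainIdx, hu]
    obtain ⟨r, hr, hlt, hwr, hcr⟩ := exists_of_lt_cnt (show chainIdx P w q < cnt P w (· = u) q by omega)
    refine ⟨r, hr, by omega, ?_, by omega⟩
    rw [← hc, ← hcr]
    simp [chainIdx, hwr]

theorem chain_le (h : IsLatticeWord P a w) {p q : ℕ} (hp : p ∈ P) (hq : q ∈ P)
    (hc : chainIdx P w p = chainIdx P w q) (hw : w p ≤ w q) : p + (w q - w p) ≤ q := by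
  have := h.pos p hp
  obtain ⟨r, hr, hwr, hcr, hle⟩ := h.exists_chain hq (w q - w p) (by omega)
  obtain rfl : r = p := eq_of_chainIdx_eq hr hp (by omega) (hcr.trans hc.symm)
  exact hle

theorem letter_le (h : IsLatticeWord P a w) {p : ℕ} (hp : p ∈ P) : w p ≤ p + 1 := by
  have := h.pos p hp
  obtain ⟨q, -, -, -, hle⟩ := h.exists_chain hp (w p - 1) (by omega)
  omega

theorem cnt_anti (h : IsLatticeWord P a w) {u v : ℕ} (hu : 0 < u) (huv : u ≤ v) (j : ℕ) :
    cnt P w (· = v) j ≤ cnt P w (· = u) j := by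
  induction v, huv using Nat.le_induction with
  | base => exact le_rfl
  | succ v hv ih => exact (h.lattice v (by omega) j).trans ih

/-- The pairs (letter, index) depend only on the content, so a word amounts to an order on a fixed
set. -/
theorem range_eq (h : IsLatticeWord P a w) (h' : IsLatticeWord P a w') :
    (∀ p ∈ P, ∃ q ∈ P, w q = w' p ∧ chainIdx P w q = chainIdx P w' p) := by
  intro p hp
  have := h'.pos p hp
  obtain ⟨q, hq, hw, hc⟩ := h.exists_of_lt_content (h'.chainIdx_lt_content hp)
  exact ⟨q, hq, by omega, hc⟩

end IsLatticeWord

/-- `p` and `q` are consecutive elements of `P`. -/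
def Adjacent (P : Finset ℕ) (p q : ℕ) : Prop :=
  p ∈ P ∧ q ∈ P ∧ p < q ∧ ∀ r ∈ P, ¬ (p < r ∧ r < q)

theorem lt_of_adjacent_lt {L : Type*} [Preorder L] {f : ℕ → L}
    (h : ∀ p q, Adjacent P p q → f p < f q) {p q : ℕ} (hp : p ∈ P) (hq : q ∈ P) (hpq : p < q) :
    f p < f q := by
  induction hd : q - p using Nat.strong_induction_on generalizing p q with
  | _ d ih =>
  by_cases hr : ∃ r ∈ P, p < r ∧ r < q
  · obtain ⟨r, hr, h1, h2⟩ := hr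
    exact (ih (r - p) (by omega) hp hr h1 rfl).trans (ih (q - r) (by omega) hr hq h2 rfl)
  · push Not at hr
    exact h p q ⟨hp, hq, hpq, fun r hrP h1 => absurd h1.2 (not_lt.2 (hr r hrP h1.1))⟩

theorem eqOn_of_strictMono {L : Type*} [LinearOrder L] {f g : ℕ → L}
    (hf : ∀ p ∈ P, ∀ q ∈ P, p < q → f p < f q) (hg : ∀ p ∈ P, ∀ q ∈ P, p < q → g p < g q)
    (hfg : ∀ p ∈ P, ∃ q ∈ P, f q = g p) (hgf : ∀ p ∈ P, ∃ q ∈ P, g q = f p) :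
    ∀ p ∈ P, f p = g p := by
  have h1 : StrictMono fun p : P => f p := fun p q hpq => hf p p.2 q q.2 hpq
  have h2 : StrictMono fun p : P => g p := fun p q hpq => hg p p.2 q q.2 hpq
  have h3 : Set.range (fun p : P => f p) = Set.range fun p : P => g p := by
    ext x
    constructor
    · rintro ⟨p, rfl⟩
      obtain ⟨q, hq, h⟩ := hgf p p.2
      exact ⟨⟨q, hq⟩, h⟩
    · rintro ⟨p, rfl⟩
      obtain ⟨q, hq, h⟩ := hfg p p.2
      exact ⟨⟨q, hq⟩, h⟩
  exact fun p hp => congrFun ((StrictMono.range_inj h1 h2).1 h3) ⟨p, hp⟩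

theorem cnt_adjacent {p q j : ℕ} (h : Adjacent P p q) (hp : p < j) (hq : j ≤ q) :
    cnt P w A j = cnt P w A p + if A (w p) then 1 else 0 := by
  induction j, (show p + 1 ≤ j from hp) using Nat.le_induction with
  | base =>
    rw [cnt_succ]
    simp [h.1]
  | succ j hj ih =>
    rw [cnt_succ, ih (by omega) (by omega), if_neg (fun hjP : j ∈ P ∧ _ => h.2.2.2 j hjP.1 (by omega)),
      add_zero]

/-- The word with the letters at `p` and `q` exchanged. -/
def swapWord (w : ℕ → ℕ) (p q : ℕ) : ℕ → ℕ := w ∘ Equiv.swap p q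

theorem swapWord_left (p q : ℕ) : swapWord w p q p = w q := by simp [swapWord]

theorem swapWord_right (p q : ℕ) : swapWord w p q q = w p := by simp [swapWord]

theorem swapWord_of_ne {p q r : ℕ} (h : r ≠ p) (h' : r ≠ q) : swapWord w p q r = w r := by
  simp [swapWord, Equiv.swap_apply_of_ne_of_ne h h']

theorem swapWord_swapWord (p q : ℕ) : swapWord (swapWord w p q) p q = w := by
  funext r
  simp [swapWord]

theorem cnt_swapWord_of_le {p q j : ℕ} (h : Adjacent P p q) (hj : j ≤ p) :
    cnt P (swapWord w p q) A j = cnt P w A j :=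
  cnt_congr fun r _ hr => swapWord_of_ne (by omega) (by have := h.2.2.1; omega)

theorem cnt_swapWord_of_lt {p q j : ℕ} (h : Adjacent P p q) (hj : q < j) :
    cnt P (swapWord w p q) A j = cnt P w A j := by
  have hpq := h.2.2.1
  induction j, (show q + 1 ≤ j from hj) using Nat.le_induction with
  | base =>
    rw [cnt_succ, cnt_succ, cnt_adjacent h hpq le_rfl, cnt_adjacent h hpq le_rfl,
      cnt_swapWord_of_le h le_rfl, swapWord_left, swapWord_right]
    simp only [h.2.1, true_and]
    omega
  | succ j hj' ih =>
    rw [cnt_succ, cnt_succ, ih (by omega), swapWord_of_ne (by omega) (by omega)]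

/-- Only the prefix that ends between `p` and `q` changes its counts; the one danger is that the
letter `u + 1` brought forward has too few letters `u` before it. -/
theorem IsLatticeWord.swapWord (hw : IsLatticeWord P a w) {p q : ℕ} (h : Adjacent P p q)
    (hne : ∀ u, 0 < u → w q = u + 1 → cnt P w (· = u + 1) p + 1 ≤ cnt P w (· = u) p) :
    IsLatticeWord P a (swapWord w p q) where
  pos r hr := by
    by_cases h1 : r = p
    · subst h1; rw [swapWord_left]; exact hw.pos _ h.2.1
    by_cases h2 : r = q
    · subst h2; rw [swapWord_right]; exact hw.pos _ h.1
    rw [swapWord_of_ne h1 h2]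
    exact hw.pos _ hr
  content u := by
    rw [← hw.content u, ← cnt_of_forall_lt (A := (· = u + 1)) fun q hq => lt_add_sup hq,
      ← cnt_of_forall_lt (A := (· = u + 1)) fun q hq => lt_add_sup hq]
    exact cnt_swapWord_of_lt h (lt_add_sup h.2.1)
  lattice u hu j := by
    rcases le_or_gt j p with hj | hj
    · rw [cnt_swapWord_of_le h hj, cnt_swapWord_of_le h hj]
      exact hw.lattice u hu j
    rcases lt_or_ge q j with hj' | hj'
    · rw [cnt_swapWord_of_lt h hj', cnt_swapWord_of_lt h hj']
      exact hw.lattice u hu j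
    rw [cnt_adjacent h hj hj', cnt_adjacent h hj hj', cnt_swapWord_of_le h le_rfl,
      cnt_swapWord_of_le h le_rfl, swapWord_left]
    have h1 := hw.lattice u hu p
    have h2 := hne u hu
    split_ifs <;> omega

theorem cnt_right {p q : ℕ} (h : Adjacent P p q) (hne : w p ≠ w q) :
    cnt P w (· = w q) p = chainIdx P w q := by
  rw [chainIdx, cnt_adjacent h h.2.2.1 le_rfl, if_neg hne, add_zero]

theorem IsLatticeWord.swapWord_aux (hw : IsLatticeWord P a w) {p q u : ℕ} (h : Adjacent P p q)
    (hu : 0 < u) (hq : w q = u + 1) (h1 : w p ≠ u) (h2 : w p ≠ u + 1) :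
    cnt P w (· = u + 1) p + 1 ≤ cnt P w (· = u) p := by
  have := hw.lattice u hu (q + 1)
  rw [cnt_succ, cnt_succ, cnt_adjacent h h.2.2.1 le_rfl, cnt_adjacent h h.2.2.1 le_rfl,
    if_neg h2, if_neg h1, if_pos ⟨h.2.1, hq⟩, if_neg (by omega)] at this
  exact this

theorem IsLatticeWord.swapWord_of_lt (hw : IsLatticeWord P a w) {p q : ℕ} (h : Adjacent P p q)
    (hlt : w q < w p) : IsLatticeWord P a (LRVar.swapWord w p q) :=
  hw.swapWord h fun u hu hq => hw.swapWord_aux h hu hq (by omega) (by omega)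

/-- The only delicate ascent is from `u` to `u + 1`. There the two indices are the counts of `u` and
`u + 1` before `p`, so the index condition is exactly what the exchange requires. -/
theorem IsLatticeWord.swapWord_of_chainIdx_lt (hw : IsLatticeWord P a w) {p q : ℕ}
    (h : Adjacent P p q) (hlt : w p < w q) (hc : chainIdx P w q < chainIdx P w p) :
    IsLatticeWord P a (LRVar.swapWord w p q) := by
  refine hw.swapWord h fun u hu hq => ?_
  by_cases hp : w p = u
  · rw [← cnt_right h hlt.ne] at hc
    unfold chainIdx at hc
    simp only [hp, hq] at hc
    exact hc
  · exact hw.swapWord_aux h hu hq hp (by omega)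

/-- Two lattice words without adjacent descents agree. -/
theorem IsLatticeWord.eqOn_of_no_descent (hw : IsLatticeWord P a w) (hw' : IsLatticeWord P a w')
    (h : ∀ p q, Adjacent P p q → w p ≤ w q) (h' : ∀ p q, Adjacent P p q → w' p ≤ w' q) :
    ∀ p ∈ P, w p = w' p := by
  -- Without descents the positions list the pairs (letter, index) in lexicographic order.
  have key : ∀ v : ℕ → ℕ, (∀ p q, Adjacent P p q → v p ≤ v q) → ∀ p ∈ P, ∀ q ∈ P, p < q →
      toLex (v p, chainIdx P v p) < toLex (v q, chainIdx P v q) := by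
    intro v hv p hp q hq hpq
    refine lt_of_adjacent_lt (f := fun p => toLex (v p, chainIdx P v p)) (fun p q hadj => ?_)
      hp hq hpq
    rw [Prod.Lex.toLex_lt_toLex]
    rcases (hv p q hadj).lt_or_eq with hlt | heq
    · exact Or.inl hlt
    · exact Or.inr ⟨heq, chainIdx_lt hadj.1 hadj.2.2.1 heq⟩
  intro p hp
  have := eqOn_of_strictMono (key w h) (key w' h')
    (fun p hp => by
      obtain ⟨q, hq, h1, h2⟩ := hw.range_eq hw' p hp
      exact ⟨q, hq, by rw [h1, h2]⟩)
    (fun p hp => by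
      obtain ⟨q, hq, h1, h2⟩ := hw'.range_eq hw p hp
      exact ⟨q, hq, by rw [h1, h2]⟩) p hp
  exact congrArg (fun x => (ofLex x).1) this

/-- Two lattice words without admissible adjacent ascents agree. -/
theorem IsLatticeWord.eqOn_of_no_ascent (hw : IsLatticeWord P a w) (hw' : IsLatticeWord P a w')
    (h : ∀ p q, Adjacent P p q → w p < w q → chainIdx P w p ≤ chainIdx P w q)
    (h' : ∀ p q, Adjacent P p q → w' p < w' q → chainIdx P w' p ≤ chainIdx P w' q) :
    ∀ p ∈ P, w p = w' p := by
  -- Now the pairs are compared by index first and by letter second.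
  have key : ∀ v : ℕ → ℕ, IsLatticeWord P a v →
      (∀ p q, Adjacent P p q → v p < v q → chainIdx P v p ≤ chainIdx P v q) →
      ∀ p ∈ P, ∀ q ∈ P, p < q → toLex (chainIdx P v p, v p) < toLex (chainIdx P v q, v q) := by
    intro v hv hasc p hp q hq hpq
    refine lt_of_adjacent_lt (f := fun p => toLex (chainIdx P v p, v p)) (fun p q hadj => ?_)
      hp hq hpq
    rw [Prod.Lex.toLex_lt_toLex]
    rcases lt_trichotomy (v p) (v q) with hlt | heq | hgt
    · rcases (hasc p q hadj hlt).lt_or_eq with h1 | h1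
      · exact Or.inl h1
      · exact Or.inr ⟨h1, hlt⟩
    · exact Or.inl (chainIdx_lt hadj.1 hadj.2.2.1 heq)
    -- At a descent the lattice condition bounds the index of the larger letter by that of the
    -- smaller. Equality would put both in one chain, where the smaller letter must come first.
    · refine Or.inl (lt_of_le_of_ne ?_ fun heq => ?_)
      · rw [← cnt_right hadj hgt.ne']
        exact hv.cnt_anti (hv.pos q hadj.2.1) hgt.le p
      · have h1 := hv.chain_le hadj.2.1 hadj.1 heq.symm hgt.le
        have h2 := hadj.2.2.1
        omega
  intro p hp
  have := eqOn_of_strictMono (key w hw h) (key w' hw' h')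
    (fun p hp => by
      obtain ⟨q, hq, h1, h2⟩ := hw.range_eq hw' p hp
      exact ⟨q, hq, by rw [h1, h2]⟩)
    (fun p hp => by
      obtain ⟨q, hq, h1, h2⟩ := hw'.range_eq hw p hp
      exact ⟨q, hq, by rw [h1, h2]⟩) p hp
  exact congrArg (fun x => (ofLex x).2) this

/-- Exchanging an adjacent ascent increases the number of large letters in prefixes. -/
theorem cnt_le_cnt_swapWord {p q : ℕ} (h : Adjacent P p q) (hlt : w p < w q) (ℓ j : ℕ) :
    cnt P w (ℓ < ·) j ≤ cnt P (swapWord w p q) (ℓ < ·) j := by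
  rcases le_or_gt j p with hj | hj
  · rw [cnt_swapWord_of_le h hj]
  rcases lt_or_ge q j with hj' | hj'
  · rw [cnt_swapWord_of_lt h hj']
  rw [cnt_adjacent h hj hj', cnt_adjacent h hj hj', cnt_swapWord_of_le h le_rfl, swapWord_left]
  split_ifs <;> omega

end Words

/-! ### Fillings of rook strips as lattice words -/

/-- The rows that contain a box of `b ∖ g`. -/
def positions (b g : YoungDiagram) : Finset ℕ :=
  (Finset.range (b.colLen 0)).filter fun p => g.rowLen p < b.rowLen p

section Fillings

variable {a b g : YoungDiagram}

theorem mem_positions {p : ℕ} : p ∈ positions b g ↔ g.rowLen p < b.rowLen p := by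
  rw [positions, Finset.mem_filter, Finset.mem_range, and_iff_right_iff_imp]
  intro h
  exact YoungDiagram.mem_iff_lt_colLen.1 (YoungDiagram.mem_iff_lt_rowLen.2 (Nat.zero_lt_of_lt h))

theorem mem_skew_iff (hrow : IsVerticalStrip b g) {c : ℕ × ℕ} :
    c ∈ b.cells \ g.cells ↔ c.1 ∈ positions b g ∧ c.2 = g.rowLen c.1 := by
  obtain ⟨i, j⟩ := c
  have := hrow i
  rw [Finset.mem_sdiff, YoungDiagram.mem_cells, YoungDiagram.mem_cells,
    YoungDiagram.mem_iff_lt_rowLen, YoungDiagram.mem_iff_lt_rowLen, mem_positions]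
  dsimp only
  omega

theorem card_filter_skew (hrow : IsVerticalStrip b g) (A : ℕ × ℕ → Prop) [DecidablePred A] :
    ((b.cells \ g.cells).filter A).card =
      ((positions b g).filter fun q => A (q, g.rowLen q)).card := by
  symm
  refine Finset.card_bij (fun q _ => (q, g.rowLen q)) (fun q hq => ?_)
    (fun _ _ _ _ h => (Prod.ext_iff.1 h).1) fun c hc => ?_
  · rw [Finset.mem_filter] at hq ⊢
    exact ⟨(mem_skew_iff hrow).2 ⟨hq.1, rfl⟩, hq.2⟩
  · rw [Finset.mem_filter, mem_skew_iff hrow] at hc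
    obtain ⟨i, j⟩ := c
    dsimp only at hc
    obtain ⟨⟨h1, rfl⟩, h2⟩ := hc
    exact ⟨i, Finset.mem_filter.2 ⟨h1, h2⟩, rfl⟩

/-- If row `q` of `g` were as long as row `p`, the column just past row `p` of `g` would contain two
boxes of the strip, in view of the box in row `q`. Consequently reading columns from right to left
is reading rows from top to bottom. -/
theorem rowLen_lt_of_lt (hcol : IsHorizontalStrip b g) {p q : ℕ}
    (hq : q ∈ positions b g) (hpq : p < q) : g.rowLen q < g.rowLen p := by
  rw [mem_positions] at hq
  by_contra hlt
  have h1 : (q, g.rowLen p) ∈ b := YoungDiagram.mem_iff_lt_rowLen.2 (by omega)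
  have h2 : (p, g.rowLen p) ∉ g := fun h => lt_irrefl _ (YoungDiagram.mem_iff_lt_rowLen.1 h)
  have h3 := hcol (g.rowLen p)
  rw [YoungDiagram.rowLen_transpose, YoungDiagram.rowLen_transpose] at h3
  rw [YoungDiagram.mem_iff_lt_colLen] at h1 h2
  omega

namespace LRFilling

/-- The letters of a filling, listed by rows. -/
def word (X : LRFilling a b g) (q : ℕ) : ℕ := X.entry (q, g.rowLen q)

theorem isLatticeWord (hrow : IsVerticalStrip b g) (hcol : IsHorizontalStrip b g)
    (X : LRFilling a b g) : IsLatticeWord (positions b g) a.rowLen X.word where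
  pos p hp := X.pos _ ((mem_skew_iff hrow).2 ⟨hp, rfl⟩)
  content u := by
    rw [← X.content u, card_filter_skew hrow]
    rfl
  lattice u hu j := by
    have hcont : ∀ v, ((positions b g).filter fun p => X.word p = v + 1).card = a.rowLen v :=
      fun v => by
        rw [← X.content v, card_filter_skew hrow]
        rfl
    -- With `q` the first position from `j` on, the prefix before `j` consists of the boxes strictly
    -- to the right of the box of `q`.
    by_cases hj : ∃ q ∈ positions b g, j ≤ q
    · classical
      obtain ⟨hqP, hjq⟩ := Nat.find_spec hj
      set q := Nat.find hj with hq
      have hmin : ∀ r ∈ positions b g, j ≤ r → q ≤ r := fun r hr hjr =>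
        Nat.find_min' hj ⟨hr, hjr⟩
      have h := X.lattice (u + 1) (by omega) (g.rowLen q)
      rw [card_filter_skew hrow, card_filter_skew hrow] at h
      rw [cnt_eq_card, cnt_eq_card]
      have hiff : ∀ r ∈ positions b g, g.rowLen q < g.rowLen r ↔ r < j := by
        intro r hr
        constructor
        · intro hlt
          by_contra hge
          have := g.rowLen_anti _ _ (hmin r hr (by omega))
          omega
        · intro hlt
          exact rowLen_lt_of_lt hcol hqP (by omega)
      have hfil : ∀ v, ((positions b g).filter fun r => r < j ∧ X.word r = v) =
          (positions b g).filter fun r => g.rowLen q < g.rowLen r ∧ X.entry (r, g.rowLen r) = v :=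
        fun v => Finset.filter_congr fun r hr => by rw [hiff r hr]; rfl
      rw [hfil, hfil]
      exact h
    -- The full word need not be the part strictly to the right of some column, since column `0` may
    -- be occupied. Here the inequality holds because the content is a partition.
    · push Not at hj
      rw [cnt_of_forall_lt hj, cnt_of_forall_lt hj, hcont]
      obtain ⟨v, rfl⟩ : ∃ v, u = v + 1 := ⟨u - 1, by omega⟩
      rw [hcont]
      exact a.rowLen_anti _ _ (Nat.le_succ v)

/-- The filling with prescribed letters. -/
def ofWord (hrow : IsVerticalStrip b g) (hcol : IsHorizontalStrip b g) (w : ℕ → ℕ)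
    (hw : IsLatticeWord (positions b g) a.rowLen w) : LRFilling a b g where
  entry c := if c ∈ b.cells \ g.cells then w c.1 else 0
  zero_off _ hc := if_neg hc
  pos c hc := by
    rw [if_pos hc]
    exact hw.pos _ ((mem_skew_iff hrow).1 hc).1
  row_weak i j₁ j₂ hlt h₁ h₂ := by
    have h1 := ((mem_skew_iff hrow).1 h₁).2
    have h2 := ((mem_skew_iff hrow).1 h₂).2
    dsimp only at h1 h2
    omega
  col_strict i₁ i₂ j hlt h₁ h₂ := by
    have h1 := (mem_skew_iff hrow).1 h₁
    have h2 := (mem_skew_iff hrow).1 h₂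
    have h3 := rowLen_lt_of_lt hcol h2.1 hlt
    have h4 := h1.2
    have h5 := h2.2
    dsimp only at h3 h4 h5
    omega
  content u := by
    rw [card_filter_skew hrow, ← hw.content u]
    refine congrArg _ (Finset.filter_congr fun q hq => ?_)
    rw [if_pos ((mem_skew_iff hrow).2 ⟨hq, rfl⟩)]
  lattice u hu j := by
    obtain ⟨v, rfl⟩ : ∃ v, u = v + 1 := ⟨u - 1, by omega⟩
    -- The boxes strictly to the right of column `j` are those in the rows before `g.colLen j`.
    have h := hw.lattice v (by omega) (g.colLen j)
    rw [cnt_eq_card, cnt_eq_card] at h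
    rw [card_filter_skew hrow, card_filter_skew hrow]
    have hfil : ∀ v, ((positions b g).filter fun r => r < g.colLen j ∧ w r = v) =
        (positions b g).filter fun r => j < g.rowLen r ∧
          (if (r, g.rowLen r) ∈ b.cells \ g.cells then w r else 0) = v :=
      fun v => Finset.filter_congr fun r hr => by
        rw [if_pos ((mem_skew_iff hrow).2 ⟨hr, rfl⟩), ← YoungDiagram.mem_iff_lt_colLen,
          YoungDiagram.mem_iff_lt_rowLen]
    rw [hfil, hfil] at h
    exact h

theorem word_ofWord (hrow : IsVerticalStrip b g) (hcol : IsHorizontalStrip b g) {w : ℕ → ℕ}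
    (hw : IsLatticeWord (positions b g) a.rowLen w) {q : ℕ} (hq : q ∈ positions b g) :
    (ofWord hrow hcol w hw).word q = w q :=
  if_pos ((mem_skew_iff hrow).2 ⟨hq, rfl⟩)

theorem ext_word (hrow : IsVerticalStrip b g) {X Z : LRFilling a b g}
    (h : ∀ q ∈ positions b g, X.word q = Z.word q) : X = Z := by
  ext c
  by_cases hc : c ∈ b.cells \ g.cells
  · have hc' := (mem_skew_iff hrow).1 hc
    obtain ⟨i, j⟩ := c
    dsimp only at hc'
    obtain ⟨h1, rfl⟩ := hc'
    exact h i h1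
  · rw [X.zero_off c hc, Z.zero_off c hc]

theorem finite (hrow : IsVerticalStrip b g) (hcol : IsHorizontalStrip b g) :
    Finite (LRFilling a b g) := by
  let F : LRFilling a b g → ((q : positions b g) → Fin (q.1 + 2)) := fun X q =>
    ⟨X.word q, Nat.lt_succ_of_le ((X.isLatticeWord hrow hcol).letter_le q.2)⟩
  refine Finite.of_injective F fun X Z h => ext_word hrow fun q hq => ?_
  exact congrArg Fin.val (congrFun h ⟨q, hq⟩)

theorem rowLen_region (hgb : g ≤ b) (hrow : IsVerticalStrip b g) (X : LRFilling a b g)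
    (ℓ q : ℕ) : (X.region ℓ).rowLen q +
      (if q ∈ positions b g ∧ ℓ < X.word q then 1 else 0) = b.rowLen q := by
  have hmem : ∀ c, c < (X.region ℓ).rowLen q ↔ c < b.rowLen q ∧ X.entry (q, c) ≤ ℓ := fun c => by
    rw [← YoungDiagram.mem_iff_lt_rowLen, mem_region, YoungDiagram.mem_iff_lt_rowLen]
  have hle : g.rowLen q ≤ b.rowLen q := by
    by_contra hlt
    have h1 : (q, b.rowLen q) ∈ g := YoungDiagram.mem_iff_lt_rowLen.2 (by omega)
    exact lt_irrefl _ (YoungDiagram.mem_iff_lt_rowLen.1 (hgb h1))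
  have hq := hrow q
  have hz : ∀ c < g.rowLen q, X.entry (q, c) = 0 := fun c hc => X.zero_off _ fun h => by
    have := ((mem_skew_iff hrow).1 h).2
    dsimp only at this
    omega
  have key : ∀ n, (∀ c, c < (X.region ℓ).rowLen q ↔ c < n) → (X.region ℓ).rowLen q = n := by
    intro n h
    have h1 := h n
    have h2 := h ((X.region ℓ).rowLen q)
    omega
  by_cases hP : q ∈ positions b g
  · have hP' := mem_positions.1 hP
    by_cases hw : ℓ < X.word q
    · rw [if_pos ⟨hP, hw⟩, key (g.rowLen q), ← Nat.succ_le_iff.2 hP' |>.antisymm hq]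
      intro c
      rw [hmem]
      constructor
      · rintro ⟨h1, h2⟩
        by_contra hc
        obtain rfl : c = g.rowLen q := by omega
        exact absurd h2 (not_le.2 hw)
      · intro hc
        exact ⟨by omega, by rw [hz c hc]; omega⟩
    · rw [if_neg fun h => hw h.2, add_zero]
      refine key _ fun c => ?_
      rw [hmem]
      refine ⟨And.left, fun hc => ⟨hc, ?_⟩⟩
      rcases lt_or_ge c (g.rowLen q) with h | h
      · rw [hz c h]; omega
      · obtain rfl : c = g.rowLen q := by omega
        exact not_lt.1 hw
  · rw [if_neg fun h => hP h.1, add_zero]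
    refine key _ fun c => ?_
    rw [mem_positions] at hP
    rw [hmem]
    exact ⟨And.left, fun hc => ⟨hc, by rw [hz c (by omega)]; omega⟩⟩

theorem sum_rowLen_region (hgb : g ≤ b) (hrow : IsVerticalStrip b g) (X : LRFilling a b g)
    (ℓ j : ℕ) : ∑ q ∈ Finset.range j, (X.region ℓ).rowLen q +
      cnt (positions b g) X.word (ℓ < ·) j = ∑ q ∈ Finset.range j, b.rowLen q := by
  induction j with
  | zero => simp [cnt]
  | succ j ih =>
    rw [Finset.sum_range_succ, Finset.sum_range_succ, cnt_succ, ← ih,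
      ← X.rowLen_region hgb hrow ℓ j]
    omega

/-- Partial row sums of a region and prefix counts of large letters add up to the partial row sums
of `b`, so dominance reverses the inequality between counts. -/
theorem le_iff (hgb : g ≤ b) (hrow : IsVerticalStrip b g) {X Z : LRFilling a b g} :
    X ≤ Z ↔ ∀ ℓ j, cnt (positions b g) Z.word (ℓ < ·) j ≤
      cnt (positions b g) X.word (ℓ < ·) j := by
  refine forall_congr' fun ℓ => forall_congr' fun j => ?_
  have h1 := X.sum_rowLen_region hgb hrow ℓ j
  have h2 := Z.sum_rowLen_region hgb hrow ℓ j
  omega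

theorem region_zero (hgb : g ≤ b) (X : LRFilling a b g) : X.region 0 = g := by
  ext c
  rw [YoungDiagram.mem_cells, YoungDiagram.mem_cells, mem_region]
  constructor
  · rintro ⟨h1, h2⟩
    by_contra h3
    have := X.pos c (by simp [h1, h3])
    omega
  · exact fun h => ⟨hgb h, (X.zero_off c (by simp [h])).le⟩

end LRFilling
end Fillings

/-! ### Words from rank functions -/

section RankFunction

variable {P : Finset ℕ} {a w : ℕ → ℕ}

theorem cnt_lt_eq_add (u j : ℕ) :
    cnt P w (u < ·) j = cnt P w (u + 1 < ·) j + cnt P w (· = u + 1) j := by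
  induction j with
  | zero => rfl
  | succ j ih =>
    rw [cnt_succ, cnt_succ, cnt_succ, ih]
    by_cases hj : j ∈ P
    · simp only [hj, true_and]
      split_ifs <;> omega
    · simp [hj]

/-- As a function of `ℓ`, the increment `r (j + 1) ℓ - r j ℓ` is weakly decreasing, starts at the
indicator of `j ∈ P` and ends at `0`. It is a step function, and the place of its drop is the letter
at `j`. Convexity in `ℓ` is then the lattice condition. -/
theorem exists_isLatticeWord_of_rank {r : ℕ → ℕ → ℕ} (h0 : ∀ ℓ, r 0 ℓ = 0)
    (hmono : ∀ j ℓ, r j ℓ ≤ r (j + 1) ℓ)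
    (hanti : ∀ j ℓ, r (j + 1) (ℓ + 1) + r j ℓ ≤ r (j + 1) ℓ + r j (ℓ + 1))
    (hinit : ∀ j, r (j + 1) 0 = r j 0 + if j ∈ P then 1 else 0)
    (hzero : ∃ L, ∀ j, r j L = 0) (hcont : ∃ J, (∀ p ∈ P, p < J) ∧ ∀ u, r J u = r J (u + 1) + a u)
    (hconv : ∀ j ℓ, 2 * r j (ℓ + 1) ≤ r j ℓ + r j (ℓ + 2)) :
    ∃ w, IsLatticeWord P a w ∧ ∀ j ℓ, r j ℓ = cnt P w (ℓ < ·) j := by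
  classical
  obtain ⟨L, hL⟩ := hzero
  have hex : ∀ j, ∃ ℓ, r (j + 1) ℓ = r j ℓ := fun j => ⟨L, by rw [hL, hL]⟩
  have hanti' : ∀ j ℓ m, ℓ ≤ m → r (j + 1) m + r j ℓ ≤ r (j + 1) ℓ + r j m := by
    intro j ℓ m hm
    induction m, hm using Nat.le_induction with
    | base => omega
    | succ m hm ih =>
      have := hanti j m
      omega
  -- The letter at `j` is the first level at which the increment vanishes.
  let w : ℕ → ℕ := fun j => Nat.find (hex j)
  have hstep : ∀ j ℓ, r (j + 1) ℓ = r j ℓ + if j ∈ P ∧ ℓ < w j then 1 else 0 := by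
    intro j ℓ
    have h1 := hinit j
    have h2 := hmono j ℓ
    have h3 := hanti' j 0 ℓ (Nat.zero_le _)
    by_cases hP : j ∈ P
    · rw [if_pos hP] at h1
      by_cases hw : ℓ < w j
      · have := Nat.find_min (hex j) hw
        rw [if_pos ⟨hP, hw⟩]
        omega
      · have h4 : r (j + 1) (w j) = r j (w j) := Nat.find_spec (hex j)
        have h5 := hanti' j (w j) ℓ (not_lt.1 hw)
        rw [if_neg fun h => hw h.2]
        omega
    · rw [if_neg hP] at h1
      rw [if_neg fun h => hP h.1]
      omega
  have hr : ∀ j ℓ, r j ℓ = cnt P w (ℓ < ·) j := by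
    intro j ℓ
    induction j with
    | zero => rw [h0]; rfl
    | succ j ih => rw [hstep, cnt_succ, ih]
  refine ⟨w, ⟨fun p hp => ?_, fun u => ?_, fun u hu j => ?_⟩, hr⟩
  · refine Nat.pos_of_ne_zero fun h => ?_
    have h4 : r (p + 1) (w p) = r p (w p) := Nat.find_spec (hex p)
    have h1 := hinit p
    rw [if_pos hp] at h1
    rw [h] at h4
    omega
  · obtain ⟨J, hJ, hcont⟩ := hcont
    have h1 := hcont u
    rw [hr, hr, cnt_lt_eq_add, cnt_of_forall_lt (A := (· = u + 1)) hJ] at h1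
    omega
  · obtain ⟨v, rfl⟩ : ∃ v, u = v + 1 := ⟨u - 1, by omega⟩
    have h1 := hconv j v
    have h2 := cnt_lt_eq_add (P := P) (w := w) v j
    have h3 := cnt_lt_eq_add (P := P) (w := w) (v + 1) j
    rw [hr, hr, hr] at h1
    simp only [show v + 1 + 1 = v + 2 by omega] at *
    omega

end RankFunction

/-! ### Jordan types of quotients -/

theorem range_pow_succ_le {k V : Type*} [Field k] [AddCommGroup V] [Module k V] {T : V →ₗ[k] V}
    (j : ℕ) : LinearMap.range (T ^ (j + 1)) ≤ LinearMap.range (T ^ j) := by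
  rw [pow_succ]
  exact LinearMap.range_comp_le_range _ _

section Quotients

variable {k V : Type*} [Field k] [AddCommGroup V] [Module k V] [FiniteDimensional k V]

theorem finrank_map_add_finrank_inf_ker {V' : Type*} [AddCommGroup V'] [Module k V']
    (S : V →ₗ[k] V') (U : Submodule k V) :
    finrank k (U.map S) + finrank k (U ⊓ LinearMap.ker S : Submodule k V) = finrank k U := by
  rw [← LinearMap.finrank_range_add_finrank_ker (S.domRestrict U), LinearMap.range_domRestrict,
    LinearMap.ker_domRestrict, ← Submodule.finrank_map_subtype_eq, Submodule.map_comap_subtype]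

/-- The dimension of the image of `W` in the cokernel of `T ^ j`. -/
noncomputable def cokerRank (T : V →ₗ[k] V) (j : ℕ) (W : Submodule k V) : ℕ :=
  finrank k (W.map (LinearMap.range (T ^ j)).mkQ)

variable {T : V →ₗ[k] V} {W W' : Submodule k V} {μ ν : YoungDiagram}

theorem cokerRank_add (j : ℕ) : cokerRank T j W +
    finrank k (W ⊓ LinearMap.range (T ^ j) : Submodule k V) = finrank k W := by
  have := finrank_map_add_finrank_inf_ker (LinearMap.range (T ^ j)).mkQ W
  rwa [Submodule.ker_mkQ] at this

/-- For an endomorphism in finite dimension, kernel and cokernel have equal dimension. The cokernel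
of `T^j` on `V ⧸ W` is the cokernel on `V` modulo the image of `W`, and the dimension of that image
is `cokerRank`. -/
theorem quotHasJordanType_iff (hT : HasJordanType T ν) (hnil : IsNilpotent T)
    (hW : W ≤ W.comap T) : QuotHasJordanType T W μ ↔ ∀ j, cokerRank T j W +
      ∑ q ∈ Finset.range j, μ.colLen q = ∑ q ∈ Finset.range j, ν.colLen q := by
  have hpow : ∀ j, ∀ hj : W ≤ W.comap (T ^ j), W.mapQ W T hW ^ j = W.mapQ W (T ^ j) hj :=
    fun j hj => (Submodule.mapQ_pow W hW j hj).symm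
  have hWj : ∀ j, W ≤ W.comap (T ^ j) := Submodule.le_comap_pow_of_le_comap W hW
  have hnil' : IsNilpotent (W.mapQ W T hW) := by
    obtain ⟨n, hn⟩ := hnil
    refine ⟨n, ?_⟩
    rw [hpow n (hWj n)]
    ext x
    simp [hn]
  have key : ∀ j, cokerRank T j W + finrank k (LinearMap.ker (W.mapQ W T hW ^ j)) =
      ∑ q ∈ Finset.range j, ν.colLen q := by
    intro j
    rw [← hT.finrank_ker_pow, hpow j (hWj j)]
    have h1 := LinearMap.finrank_range_add_finrank_ker (W.mapQ W (T ^ j) (hWj j))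
    have h2 := LinearMap.finrank_range_add_finrank_ker (T ^ j)
    have h3 := cokerRank_add (T := T) (W := W) j
    have h4 := finrank_map_add_finrank_inf_ker W.mkQ (LinearMap.range (T ^ j))
    have h5 := W.finrank_quotient_add_finrank
    have h6 : LinearMap.range (W.mapQ W (T ^ j) (hWj j)) =
        (LinearMap.range (T ^ j)).map W.mkQ := by
      rw [Submodule.range_mapQ]
    rw [Submodule.ker_mkQ, inf_comm] at h4
    rw [h6] at h1
    omega
  unfold QuotHasJordanType
  rw [exists_prop_of_true hW, hasJordanType_iff hnil']
  refine forall_congr' fun j => ?_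
  have := key j
  omega

theorem cokerRank_zero : cokerRank T 0 W = 0 := by
  have h := cokerRank_add (T := T) (W := W) 0
  rw [pow_zero, Module.End.one_eq_id, LinearMap.range_id, inf_top_eq] at h
  omega

theorem cokerRank_of_pow_eq_zero {j : ℕ} (hj : T ^ j = 0) : cokerRank T j W = finrank k W := by
  have h := cokerRank_add (T := T) (W := W) j
  rw [hj, LinearMap.range_zero, inf_bot_eq, finrank_bot] at h
  exact h

theorem cokerRank_le_succ (j : ℕ) : cokerRank T j W ≤ cokerRank T (j + 1) W := by
  have h1 := cokerRank_add (T := T) (W := W) j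
  have h2 := cokerRank_add (T := T) (W := W) (j + 1)
  have h3 := Submodule.finrank_mono (inf_le_inf_left W (range_pow_succ_le (T := T) j))
  omega

/-- With `R_j` the range of `T^j`, the increment in `j` is the dimension of `(W ∩ R_j) / (W ∩
R_(j+1))`, into which the same quotient for `W'` embeds. -/
theorem cokerRank_succ_anti (h : W' ≤ W) (j : ℕ) :
    cokerRank T (j + 1) W' + cokerRank T j W ≤ cokerRank T (j + 1) W + cokerRank T j W' := by
  have h1 := cokerRank_add (T := T) (W := W) j
  have h2 := cokerRank_add (T := T) (W := W) (j + 1)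
  have h3 := cokerRank_add (T := T) (W := W') j
  have h4 := cokerRank_add (T := T) (W := W') (j + 1)
  have hle := range_pow_succ_le (T := T) j
  have h5 := Submodule.finrank_sup_add_finrank_inf_eq (W' ⊓ LinearMap.range (T ^ j))
    (W ⊓ LinearMap.range (T ^ (j + 1)))
  have h6 : (W' ⊓ LinearMap.range (T ^ j)) ⊓ (W ⊓ LinearMap.range (T ^ (j + 1))) =
      W' ⊓ LinearMap.range (T ^ (j + 1)) := by
    rw [inf_inf_inf_comm, inf_eq_left.2 h, inf_eq_right.2 hle]
  have h7 := Submodule.finrank_mono (sup_le (inf_le_inf_right (LinearMap.range (T ^ j)) h)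
    (inf_le_inf_left W hle))
  rw [h6] at h5
  omega

/-- In the cokernel of `T^j`, the drop from `W` to `T W` is the dimension of the part of the image
of `W` killed by `T`; this part shrinks when `W` is replaced by `T W`. -/
theorem cokerRank_convex (hW : W.map T ≤ W) (j : ℕ) :
    2 * cokerRank T j (W.map T) ≤ cokerRank T j W + cokerRank T j ((W.map T).map T) := by
  set R := LinearMap.range (T ^ j) with hR
  have hRT : R ≤ R.comap T := by
    rintro _ ⟨x, rfl⟩
    exact ⟨T x, by rw [← Module.End.mul_apply, ← pow_succ, pow_succ', Module.End.mul_apply]⟩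
  have hmap : ∀ U : Submodule k V, (U.map T).map R.mkQ = (U.map R.mkQ).map (R.mapQ R T hRT) := by
    intro U
    rw [← Submodule.map_comp, ← Submodule.map_comp]
    rfl
  have h1 := finrank_map_add_finrank_inf_ker (R.mapQ R T hRT) (W.map R.mkQ)
  have h2 := finrank_map_add_finrank_inf_ker (R.mapQ R T hRT) ((W.map T).map R.mkQ)
  have h3 := Submodule.finrank_mono (inf_le_inf_right (LinearMap.ker (R.mapQ R T hRT))
    (Submodule.map_mono (f := R.mkQ) hW))
  rw [← hmap] at h1 h2
  unfold cokerRank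
  rw [← hR]
  omega

end Quotients

/-! ### The decomposition of the variety -/

section Decomposition

variable {k : Type*} [Field k] {α β γ : YoungDiagram}

theorem hasJordanType_nilOp : HasJordanType (nilOp k β) β := ⟨LinearEquiv.refl _ _, fun _ => rfl⟩

/-- The rank function of a homomorphism. -/
noncomputable def homRank (f : NilSpace k α →ₗ[k] NilSpace k β) (j ℓ : ℕ) : ℕ :=
  cokerRank (nilOp k β) j ((LinearMap.range f).map (nilOp k β ^ ℓ))

variable {f : NilSpace k α →ₗ[k] NilSpace k β}

theorem comm_pow (hf : ∀ v, f (nilOp k α v) = nilOp k β (f v)) (ℓ : ℕ) (v : NilSpace k α) :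
    f ((nilOp k α ^ ℓ) v) = (nilOp k β ^ ℓ) (f v) := by
  induction ℓ generalizing v with
  | zero => rfl
  | succ ℓ ih => rw [pow_succ, pow_succ, Module.End.mul_apply, Module.End.mul_apply, ih, hf]

theorem map_range_pow_succ_le (hf : ∀ v, f (nilOp k α v) = nilOp k β (f v)) (ℓ : ℕ) :
    (LinearMap.range f).map (nilOp k β ^ (ℓ + 1)) ≤ (LinearMap.range f).map (nilOp k β ^ ℓ) := by
  rintro _ ⟨_, ⟨v, rfl⟩, rfl⟩
  refine ⟨f (nilOp k α v), ⟨_, rfl⟩, ?_⟩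
  rw [hf, pow_succ, Module.End.mul_apply]

theorem map_range_pow_succ (ℓ : ℕ) : (LinearMap.range f).map (nilOp k β ^ (ℓ + 1)) =
    ((LinearMap.range f).map (nilOp k β ^ ℓ)).map (nilOp k β) := by
  rw [pow_succ', Module.End.mul_eq_comp, Submodule.map_comp]

theorem map_range_pow_le_comap (hf : ∀ v, f (nilOp k α v) = nilOp k β (f v)) (ℓ : ℕ) :
    (LinearMap.range f).map (nilOp k β ^ ℓ) ≤
      ((LinearMap.range f).map (nilOp k β ^ ℓ)).comap (nilOp k β) := by
  rw [← Submodule.map_le_iff_le_comap, ← map_range_pow_succ]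
  exact map_range_pow_succ_le hf ℓ

theorem finrank_map_range_pow (hf : ∀ v, f (nilOp k α v) = nilOp k β (f v))
    (hinj : Function.Injective f) (u : ℕ) :
    finrank k ((LinearMap.range f).map (nilOp k β ^ u)) +
      ∑ q ∈ Finset.range u, α.colLen q = finrank k (NilSpace k α) := by
  have h1 : (LinearMap.range f).map (nilOp k β ^ u) = (LinearMap.range (nilOp k α ^ u)).map f := by
    rw [← LinearMap.range_comp, ← LinearMap.range_comp]
    congr 1
    ext1 v
    exact LinearMap.ext fun v => (comm_pow hf u _).symm
  have h2 := finrank_map_add_finrank_inf_ker f (LinearMap.range (nilOp k α ^ u))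
  have h3 := LinearMap.finrank_range_add_finrank_ker (nilOp k α ^ u)
  rw [LinearMap.ker_eq_bot.2 hinj, inf_bot_eq, finrank_bot] at h2
  rw [finrank_ker_nilOp_pow] at h3
  rw [h1]
  omega

theorem quotHasJordanType_transpose_iff (hf : ∀ v, f (nilOp k α v) = nilOp k β (f v))
    (hγβ : γ ≤ β) (hrow : IsHorizontalStrip β γ)
    (X : LRFilling α.transpose β.transpose γ.transpose) (ℓ : ℕ) :
    QuotHasJordanType (nilOp k β) ((LinearMap.range f).map (nilOp k β ^ ℓ))
      (X.region ℓ).transpose ↔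
    ∀ j, homRank f j ℓ = cnt (positions β.transpose γ.transpose) X.word (ℓ < ·) j := by
  rw [quotHasJordanType_iff hasJordanType_nilOp isNilpotent_nilOp (map_range_pow_le_comap hf ℓ)]
  refine forall_congr' fun j => ?_
  have h := X.sum_rowLen_region (YoungDiagram.transpose_mono hγβ) hrow ℓ j
  simp only [YoungDiagram.rowLen_transpose, YoungDiagram.colLen_transpose] at h ⊢
  unfold homRank
  omega

theorem mem_component_iff (hγβ : γ ≤ β) (hrow : IsHorizontalStrip β γ)
    (X : LRFilling α.transpose β.transpose γ.transpose) (f : SESVariety k α β γ) :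
    f ∈ component k X ↔
      ∀ ℓ j, homRank f.1 j ℓ = cnt (positions β.transpose γ.transpose) X.word (ℓ < ·) j :=
  forall_congr' fun ℓ => quotHasJordanType_transpose_iff f.2.1 hγβ hrow X ℓ

theorem exists_mem_component (hγβ : γ ≤ β) (hrow : IsHorizontalStrip β γ)
    (hcol : IsVerticalStrip β γ) (f : SESVariety k α β γ) :
    ∃ X : LRFilling α.transpose β.transpose γ.transpose, f ∈ component k X := by
  obtain ⟨f, hf, hinj, hquot⟩ := f
  have hcol' : IsHorizontalStrip β.transpose γ.transpose := by
    unfold IsHorizontalStrip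
    rwa [YoungDiagram.transpose_transpose, YoungDiagram.transpose_transpose]
  set P := positions β.transpose γ.transpose with hP
  have hmap : (LinearMap.range f).map (nilOp k β ^ 0) = LinearMap.range f := by
    rw [pow_zero, Module.End.one_eq_id, Submodule.map_id]
  have h0 : ∀ j, homRank f j 0 + ∑ q ∈ Finset.range j, γ.colLen q =
      ∑ q ∈ Finset.range j, β.colLen q := by
    unfold homRank
    rw [hmap]
    exact (quotHasJordanType_iff hasJordanType_nilOp isNilpotent_nilOp hquot.1).1 hquot
  obtain ⟨w, hw, hr⟩ := exists_isLatticeWord_of_rank (P := P) (a := α.transpose.rowLen)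
    (r := homRank f) (fun ℓ => cokerRank_zero) (fun j ℓ => cokerRank_le_succ j)
    (fun j ℓ => cokerRank_succ_anti (map_range_pow_succ_le hf ℓ) j)
    (fun j => by
      have h1 := h0 j
      have h2 := h0 (j + 1)
      have h3 := hrow j
      have h4 := mem_positions (b := β.transpose) (g := γ.transpose) (p := j)
      rw [Finset.sum_range_succ, Finset.sum_range_succ] at h2
      rw [← hP] at h4
      simp only [YoungDiagram.rowLen_transpose] at h3 h4
      by_cases hj : j ∈ P
      · rw [if_pos hj]
        have := h4.1 hj
        omega
      · rw [if_neg hj]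
        have := mt h4.2 hj
        have h5 : γ.colLen j ≤ β.colLen j := by
          by_contra h
          have h6 : (β.colLen j, j) ∈ γ := YoungDiagram.mem_iff_lt_colLen.2 (by omega)
          exact lt_irrefl _ (YoungDiagram.mem_iff_lt_colLen.1 (hγβ h6))
        omega)
    -- The longest row of `β` bounds the nilpotency index, so it serves as the level where all ranks
    -- vanish and, next, as the `j` for which `B / T^j B` is all of `B`.
    ⟨β.rowLen 0, fun j => by
      unfold homRank cokerRank
      rw [nilOp_pow_eq_zero le_rfl, Submodule.map_zero, Submodule.map_bot, finrank_bot]⟩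
    ⟨β.rowLen 0, fun p hp => by
      have h4 := mem_positions.1 hp
      rw [YoungDiagram.rowLen_transpose, YoungDiagram.rowLen_transpose] at h4
      exact YoungDiagram.mem_iff_lt_rowLen.1
        (YoungDiagram.mem_iff_lt_colLen.2 (Nat.zero_lt_of_lt h4)), fun u => by
      unfold homRank
      rw [cokerRank_of_pow_eq_zero (nilOp_pow_eq_zero le_rfl),
        cokerRank_of_pow_eq_zero (nilOp_pow_eq_zero le_rfl)]
      have h1 := finrank_map_range_pow hf hinj u
      have h2 := finrank_map_range_pow hf hinj (u + 1)
      rw [Finset.sum_range_succ] at h2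
      rw [YoungDiagram.rowLen_transpose]
      omega⟩
    (fun j ℓ => by
      have := cokerRank_convex (T := nilOp k β) (W := (LinearMap.range f).map (nilOp k β ^ ℓ))
        (by rw [← map_range_pow_succ]; exact map_range_pow_succ_le hf ℓ) j
      rwa [← map_range_pow_succ, ← map_range_pow_succ] at this)
  refine ⟨LRFilling.ofWord hrow hcol' w hw, (mem_component_iff hγβ hrow _ _).2 fun ℓ j => ?_⟩
  rw [hr]
  exact cnt_congr fun q hq _ => (LRFilling.word_ofWord hrow hcol' hw hq).symm

theorem eq_of_mem_component (hγβ : γ ≤ β) (hrow : IsHorizontalStrip β γ)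
    {X Z : LRFilling α.transpose β.transpose γ.transpose} {f : SESVariety k α β γ}
    (hX : f ∈ component k X) (hZ : f ∈ component k Z) : X = Z := by
  rw [mem_component_iff hγβ hrow] at hX hZ
  refine le_antisymm ?_ ?_ <;>
  · rw [LRFilling.le_iff (YoungDiagram.transpose_mono hγβ) hrow]
    intro ℓ j
    rw [← hX, ← hZ]

end Decomposition

/-! ### Topology of the variety -/

section Topology

variable {k : Type*} [Field k] {α β γ : YoungDiagram}

theorem isClosed_zariski_iff {σ : Type*} {S : Set (σ → k)} : @IsClosed _ (zariski k σ) S ↔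
    ∃ P : Set (MvPolynomial σ k), S = {x | ∀ p ∈ P, MvPolynomial.eval x p = 0} := by
  rw [← @isOpen_compl_iff _ _ (zariski k σ)]
  change Sᶜᶜ ∈ _ ↔ _
  rw [compl_compl]
  rfl

/-- The matrix entries of a homomorphism. -/
noncomputable def entries (f : NilSpace k α →ₗ[k] NilSpace k β) : β.cells × α.cells → k :=
  fun p => LinearMap.toMatrix' f p.1 p.2

theorem isClosed_iff {S : Set (SESVariety k α β γ)} : IsClosed S ↔
    ∃ P : Set (MvPolynomial (β.cells × α.cells) k),
      S = {f | ∀ p ∈ P, MvPolynomial.eval (entries f.1) p = 0} := by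
  have h : (inferInstance : TopologicalSpace (SESVariety k α β γ)) =
      TopologicalSpace.induced (fun f => entries f.1) (zariski k (β.cells × α.cells)) :=
    induced_compose
  change @IsClosed _ inferInstance S ↔ _
  rw [h, @isClosed_induced_iff _ _ (zariski k (β.cells × α.cells))]
  constructor
  · rintro ⟨U, hU, rfl⟩
    obtain ⟨P, rfl⟩ := isClosed_zariski_iff.1 hU
    exact ⟨P, rfl⟩
  · rintro ⟨P, rfl⟩
    exact ⟨_, isClosed_zariski_iff.2 ⟨P, rfl⟩, rfl⟩

theorem isOpen_eval_ne_zero (p : MvPolynomial (β.cells × α.cells) k) :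
    IsOpen {f : SESVariety k α β γ | MvPolynomial.eval (entries f.1) p ≠ 0} := by
  rw [← isClosed_compl_iff, isClosed_iff]
  refine ⟨{p}, ?_⟩
  ext f
  simp

/-- A polynomial that computes the determinant of `A ∘ f ∘ B`. -/
theorem exists_polynomial_det (r : ℕ) (A : NilSpace k β →ₗ[k] (Fin r → k))
    (B : (Fin r → k) →ₗ[k] NilSpace k α) : ∃ p : MvPolynomial (β.cells × α.cells) k,
      ∀ f, MvPolynomial.eval (entries f) p = LinearMap.det (A ∘ₗ f ∘ₗ B) := by
  let M : Matrix β.cells α.cells (MvPolynomial (β.cells × α.cells) k) :=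
    Matrix.of fun i j => MvPolynomial.X (i, j)
  let N₁ : Matrix (Fin r) β.cells (MvPolynomial (β.cells × α.cells) k) :=
    (LinearMap.toMatrix' A).map MvPolynomial.C
  let N₂ : Matrix α.cells (Fin r) (MvPolynomial (β.cells × α.cells) k) :=
    (LinearMap.toMatrix' B).map MvPolynomial.C
  refine ⟨(N₁ * (M * N₂)).det, fun f => ?_⟩
  have h1 : M.map (MvPolynomial.eval (entries f)) = LinearMap.toMatrix' f := by
    ext i j
    simp [M, entries]
  have h2 : ∀ {m n : Type} (N : Matrix m n k),
      (N.map MvPolynomial.C).map (MvPolynomial.eval (entries f)) = N := by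
    intro m n N
    ext i j
    simp
  rw [RingHom.map_det, ← LinearMap.det_toMatrix', LinearMap.toMatrix'_comp,
    LinearMap.toMatrix'_comp, RingHom.mapMatrix_apply, Matrix.map_mul, Matrix.map_mul, h1, h2, h2]

theorem homRank_eq (f : NilSpace k α →ₗ[k] NilSpace k β) (j ℓ : ℕ) : homRank f j ℓ =
    finrank k (LinearMap.range
      (((LinearMap.range (nilOp k β ^ j)).mkQ ∘ₗ (nilOp k β ^ ℓ)) ∘ₗ f)) := by
  rw [LinearMap.range_comp, Submodule.map_comp]
  rfl

/-- Rank at least `r` means that the identity of `k^r` factors through `F`; this turns a rank bound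
into the nonvanishing of one determinant. -/
theorem le_finrank_range_iff {V W : Type*} [AddCommGroup V] [Module k V] [AddCommGroup W]
    [Module k W] [FiniteDimensional k W] (F : V →ₗ[k] W) (r : ℕ) :
    r ≤ finrank k (LinearMap.range F) ↔ ∃ (A : W →ₗ[k] (Fin r → k)) (B : (Fin r → k) →ₗ[k] V),
      A ∘ₗ F ∘ₗ B = LinearMap.id := by
  constructor
  · intro h
    let b := finBasis k (LinearMap.range F)
    have hli : LinearIndependent k fun i : Fin r => (b (Fin.castLE h i)).1 :=
      (b.linearIndependent.comp _ (Fin.castLE_injective h)).map' _ (Submodule.ker_subtype _)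
    choose v hv using fun i : Fin r => (b (Fin.castLE h i)).2
    have hY : F ∘ₗ Fintype.linearCombination k v =
        Fintype.linearCombination k fun i : Fin r => (b (Fin.castLE h i)).1 := by
      refine LinearMap.ext fun x => ?_
      simp [Fintype.linearCombination_apply, hv]
    obtain ⟨A, hA⟩ := LinearMap.exists_leftInverse_of_injective
      (F ∘ₗ Fintype.linearCombination k v) (by
        rw [hY, LinearMap.ker_eq_bot]
        exact hli.fintypeLinearCombination_injective)
    exact ⟨A, _, hA⟩
  · rintro ⟨A, B, h⟩
    have h1 : LinearMap.range (A ∘ₗ F ∘ₗ B) ≤ (LinearMap.range F).map A := by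
      rintro _ ⟨x, rfl⟩
      exact ⟨_, ⟨B x, rfl⟩, rfl⟩
    have h2 := (Submodule.finrank_mono h1).trans (Submodule.finrank_map_le A _)
    rwa [h, LinearMap.range_id, finrank_top, finrank_fin_fun] at h2

theorem isOpen_le_homRank (r j ℓ : ℕ) :
    IsOpen {f : SESVariety k α β γ | r ≤ homRank f.1 j ℓ} := by
  rw [isOpen_iff_forall_mem_open]
  intro f₀ hf₀
  rw [Set.mem_ofPred_eq, homRank_eq, le_finrank_range_iff] at hf₀
  obtain ⟨A, B, hAB⟩ := hf₀
  obtain ⟨p, hp⟩ := exists_polynomial_det r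
    (A ∘ₗ (LinearMap.range (nilOp k β ^ j)).mkQ ∘ₗ (nilOp k β ^ ℓ)) B
  refine ⟨_, fun f hf => ?_, isOpen_eval_ne_zero p, ?_⟩
  · rw [Set.mem_ofPred_eq, hp] at hf
    rw [Set.mem_ofPred_eq, homRank_eq, le_finrank_range_iff]
    -- Near `f₀` the composite is only invertible, not the identity; its inverse is absorbed into
    -- `A`.
    let e := LinearMap.equivOfDetNeZero _ hf
    refine ⟨e.symm.toLinearMap ∘ₗ A, B, LinearMap.ext fun x => e.symm_apply_apply x⟩
  · rw [Set.mem_ofPred_eq, hp]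
    refine ne_of_eq_of_ne (congrArg LinearMap.det hAB) ?_
    rw [LinearMap.det_id]
    exact one_ne_zero

theorem mem_of_isClosed_of_line [Infinite k] {S : Set (SESVariety k α β γ)} (hS : IsClosed S)
    {f : k → SESVariety k α β γ} {f₀ g : NilSpace k α →ₗ[k] NilSpace k β}
    (hf : ∀ t, (f t).1 = f₀ + t • g) (h : ∀ t, t ≠ 0 → f t ∈ S) : f 0 ∈ S := by
  obtain ⟨P, rfl⟩ := isClosed_iff.1 hS
  intro p hp
  let q : Polynomial k := MvPolynomial.eval₂ Polynomial.C
    (fun c => Polynomial.C (entries f₀ c) + Polynomial.X * Polynomial.C (entries g c)) p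
  have hq : ∀ t, q.eval t = MvPolynomial.eval (entries (f t).1) p := by
    intro t
    have : entries (f t).1 = fun c => entries f₀ c + entries g c * t := by
      funext c
      simp [entries, hf, mul_comm t]
    rw [this]
    simp only [q]
    rw [← Polynomial.coe_evalRingHom, MvPolynomial.hom_eval₂]
    simp [MvPolynomial.eval_eq', MvPolynomial.eval₂_eq']
  -- The restriction `q` of the equation to the line vanishes off `0`, and the factor `X` removes
  -- the exception; a polynomial vanishing on an infinite field is zero.
  have hX : Polynomial.X * q = 0 := by
    refine Polynomial.funext fun t => ?_
    rw [Polynomial.eval_mul, Polynomial.eval_X, Polynomial.eval_zero, hq]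
    rcases eq_or_ne t 0 with rfl | ht
    · rw [zero_mul]
    · rw [h t ht p hp, mul_zero]
  rw [← hq, (mul_eq_zero.1 hX).resolve_left Polynomial.X_ne_zero, Polynomial.eval_zero]

end Topology

/-! ### Embeddings with prescribed word -/

section Construction

variable {P : Finset ℕ} {a w : ℕ → ℕ} {p₀ p₁ : ℕ}

/-- The exchange of an adjacent ascent is admissible (void if `p₀` is not a position). -/
def Exchangeable (P : Finset ℕ) (a w : ℕ → ℕ) (p₀ p₁ : ℕ) : Prop :=
  p₀ ≠ p₁ ∧ (p₀ ∈ P → Adjacent P p₀ p₁ ∧ w p₀ < w p₁ ∧ IsLatticeWord P a (swapWord w p₀ p₁))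

theorem chainIdx_swapWord_of_ne (h : Adjacent P p₀ p₁) {q : ℕ} (hq : q ∈ P) (h0 : q ≠ p₀)
    (h1 : q ≠ p₁) : chainIdx P (swapWord w p₀ p₁) q = chainIdx P w q := by
  unfold chainIdx
  simp only [swapWord_of_ne h0 h1]
  rcases le_or_gt q p₀ with hle | hlt
  · exact cnt_swapWord_of_le h hle
  · refine cnt_swapWord_of_lt h ?_
    have := h.2.2.2 q hq
    omega

theorem chainIdx_swapWord_left (h : Adjacent P p₀ p₁) (hne : w p₀ ≠ w p₁) :
    chainIdx P (swapWord w p₀ p₁) p₀ = chainIdx P w p₁ := by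
  rw [← cnt_right h hne]
  unfold chainIdx
  simp only [swapWord_left]
  exact cnt_swapWord_of_le h le_rfl

theorem chainIdx_swapWord_right (h : Adjacent P p₀ p₁) (hne : w p₀ ≠ w p₁) :
    chainIdx P (swapWord w p₀ p₁) p₁ = chainIdx P w p₀ := by
  have := chainIdx_swapWord_left (w := swapWord w p₀ p₁) h
    (by rw [swapWord_left, swapWord_right]; exact hne.symm)
  rw [swapWord_swapWord] at this
  exact this.symm

/-- In the exchanged word `p₀` takes over the letter and index of `p₁`, so the chain of `p₁` below
its letter already fits before `p₀`. The position `p₀` is not in that chain, since the exchange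
would put the larger letter first. -/
theorem Exchangeable.below (h : Exchangeable P a w p₀ p₁) (h0 : p₀ ∈ P)
    {q m : ℕ} (hq : q ∈ P) (hm : 0 < m) (hc : chainIdx P w q = chainIdx P w p₁)
    (hl : w q + m = w p₁) : q + m ≤ p₀ := by
  obtain ⟨-, h⟩ := h
  obtain ⟨hadj, hlt, hX⟩ := h h0
  have hqp : q ≠ p₁ := by rintro rfl; omega
  have hqp0 : q ≠ p₀ := by
    rintro rfl
    have := hX.chain_le hadj.2.1 h0
      (by rw [chainIdx_swapWord_left hadj hlt.ne, chainIdx_swapWord_right hadj hlt.ne, hc])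
      (by rw [swapWord_left, swapWord_right]; omega)
    have := hadj.2.2.1
    omega
  have := hX.chain_le hq h0
    (by rw [chainIdx_swapWord_left hadj hlt.ne, chainIdx_swapWord_of_ne hadj hq hqp0 hqp, hc])
    (by rw [swapWord_left, swapWord_of_ne hqp0 hqp]; omega)
  rw [swapWord_left, swapWord_of_ne hqp0 hqp] at this
  omega

/-- Dually, `p₁` takes over the letter and index of `p₀`, so larger letters of that chain come after
`p₁`. -/
theorem Exchangeable.above (h : Exchangeable P a w p₀ p₁) (h0 : p₀ ∈ P)
    {q m : ℕ} (hq : q ∈ P) (hm : 0 < m) (hc : chainIdx P w q = chainIdx P w p₀)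
    (hl : w p₀ + m = w q) : p₁ + m ≤ q := by
  obtain ⟨-, h⟩ := h
  obtain ⟨hadj, hlt, hX⟩ := h h0
  have hqp : q ≠ p₀ := by rintro rfl; omega
  have hqp1 : q ≠ p₁ := by
    rintro rfl
    have := hX.chain_le hadj.2.1 h0
      (by rw [chainIdx_swapWord_left hadj hlt.ne, chainIdx_swapWord_right hadj hlt.ne, hc])
      (by rw [swapWord_left, swapWord_right]; omega)
    have := hadj.2.2.1
    omega
  have := hX.chain_le hadj.2.1 hq
    (by rw [chainIdx_swapWord_right hadj hlt.ne, chainIdx_swapWord_of_ne hadj hq hqp hqp1, hc])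
    (by rw [swapWord_right, swapWord_of_ne hqp hqp1]; omega)
  rw [swapWord_right, swapWord_of_ne hqp hqp1] at this
  omega

/-- The box of `α` that carries the socle coordinate of the position `q`. -/
def chainCell (P : Finset ℕ) (w : ℕ → ℕ) (α : YoungDiagram) (q : ℕ) : ℕ × ℕ :=
  (chainIdx P w q, α.rowLen (chainIdx P w q) - w q)

/-! ### Positions of a lattice word as boxes of `α`. -/

section Cells

variable {k : Type*} [Field k] {α β γ : YoungDiagram}

theorem letter_le_rowLen (hw : IsLatticeWord P α.transpose.rowLen w) {q : ℕ} (hq : q ∈ P) :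
    w q ≤ α.rowLen (chainIdx P w q) := by
  have h := hw.chainIdx_lt_content hq
  rw [YoungDiagram.rowLen_transpose, ← YoungDiagram.mem_iff_lt_colLen,
    YoungDiagram.mem_iff_lt_rowLen] at h
  omega

theorem chainCell_mem (hw : IsLatticeWord P α.transpose.rowLen w) {q : ℕ} (hq : q ∈ P) :
    chainCell P w α q ∈ α := by
  have h := letter_le_rowLen hw hq
  have h' := hw.pos q hq
  exact YoungDiagram.mem_iff_lt_rowLen.2 (by omega)

theorem chainCell_injOn (hw : IsLatticeWord P α.transpose.rowLen w) {p q : ℕ} (hp : p ∈ P)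
    (hq : q ∈ P) (h : chainCell P w α p = chainCell P w α q) : p = q := by
  obtain ⟨h1, h2⟩ := Prod.ext_iff.1 h
  dsimp only [chainCell] at h1 h2
  have h3 := letter_le_rowLen hw hp
  have h4 := letter_le_rowLen hw hq
  rw [h1] at h2 h3
  exact eq_of_chainIdx_eq hp hq (by omega) h1

theorem exists_chainCell_eq (hw : IsLatticeWord P α.transpose.rowLen w) {c : ℕ × ℕ} (hc : c ∈ α) :
    ∃ q ∈ P, chainCell P w α q = c ∧ w q + c.2 = α.rowLen c.1 := by
  obtain ⟨i, j⟩ := c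
  have hj := YoungDiagram.mem_iff_lt_rowLen.1 hc
  have h1 : (i, α.rowLen i - j - 1) ∈ α := YoungDiagram.mem_iff_lt_rowLen.2 (by omega)
  rw [YoungDiagram.mem_iff_lt_colLen, ← YoungDiagram.rowLen_transpose] at h1
  obtain ⟨q, hq, hwq, rfl⟩ := hw.exists_of_lt_content h1
  exact ⟨q, hq, Prod.ext rfl (by dsimp only [chainCell]; omega), by dsimp only; omega⟩

/-- Moving `m` columns to the right lowers the letter by `m` within the same chain, hence reaches a
position at most `p - m`, or leaves the row of `α`. -/
theorem coord_chain_eq_zero (hw : IsLatticeWord P α.transpose.rowLen w) (v : NilSpace k α)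
    {p m : ℕ} (hp : p ∈ P) (h : ∀ q ∈ P, w q + m = w p → chainIdx P w q = chainIdx P w p →
      q + m ≤ p → coord v (chainCell P w α q) = 0) :
    coord v ((chainCell P w α p).1, (chainCell P w α p).2 + m) = 0 := by
  have h1 := letter_le_rowLen hw hp
  by_cases hm : m < w p
  · obtain ⟨q, hq, hl, hc, hle⟩ := hw.exists_chain hp m hm
    rw [← h q hq hl hc hle]
    congr 1
    dsimp only [chainCell]
    rw [hc]
    exact Prod.ext rfl (by dsimp only; omega)
  · refine coord_of_notMem _ fun hmem => ?_
    have := YoungDiagram.mem_iff_lt_rowLen.1 hmem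
    dsimp only [chainCell] at this
    omega

theorem mem_range_nilOp_pow {μ : YoungDiagram} {j : ℕ} {v : NilSpace k μ} :
    v ∈ LinearMap.range (nilOp k μ ^ j) ↔ ∀ i m, μ.rowLen i ≤ m + j → coord v (i, m) = 0 := by
  constructor
  · rintro ⟨u, rfl⟩ i m hm
    rw [coord_nilOp_pow]
    refine coord_of_notMem _ fun hmem => ?_
    have := YoungDiagram.mem_iff_lt_rowLen.1 hmem
    omega
  · intro h
    refine ⟨fun c => coord v (c.1.1, c.1.2 - j), ext_coord fun ⟨i, m⟩ => ?_⟩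
    rw [coord_nilOp_pow]
    by_cases hm : (i, m + j) ∈ μ.cells
    · simp [coord, hm]
    · have hm' : (i, m + j) ∉ μ := by simpa using hm
      rw [coord_of_notMem _ hm', h i m]
      rw [YoungDiagram.mem_iff_lt_rowLen] at hm'
      omega

/-- The range of `T^ℓ` consists of the vectors that vanish on the last `ℓ` boxes of each row, which
are the boxes with letter at most `ℓ`; the other coordinates are free. -/
theorem exists_coord_nilOp_pow (hw : IsLatticeWord P α.transpose.rowLen w) (ℓ : ℕ) (x : ℕ → k) :
    ∃ v : NilSpace k α, ∀ q ∈ P, coord ((nilOp k α ^ ℓ) v) (chainCell P w α q) =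
      if ℓ < w q then x q else 0 := by
  choose! s hs hsc hsw using fun c (hc : c ∈ α) => exists_chainCell_eq hw hc
  let u : NilSpace k α := fun c => if ℓ < w (s c) then x (s c) else 0
  have hu : ∀ c ∈ α, coord u c = if ℓ < w (s c) then x (s c) else 0 := fun c hc => by
    rw [coord, dif_pos (by simpa using hc)]
  have hmem : u ∈ LinearMap.range (nilOp k α ^ ℓ) := by
    rw [mem_range_nilOp_pow]
    intro i m hm
    by_cases hc : (i, m) ∈ α
    · have := hsw _ hc
      dsimp only at this
      rw [hu _ hc, if_neg (by omega)]
    · exact coord_of_notMem _ hc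
  obtain ⟨v, hv⟩ := hmem
  refine ⟨v, fun q hq => ?_⟩
  have hc := chainCell_mem hw hq
  rw [hv, hu _ hc, chainCell_injOn hw (hs _ hc) hq (hsc _ hc)]

theorem coord_nilOp_pow_chainCell (hw : IsLatticeWord P α.transpose.rowLen w) {ℓ q : ℕ}
    (hq : q ∈ P) (h : w q ≤ ℓ) (v : NilSpace k α) :
    coord ((nilOp k α ^ ℓ) v) (chainCell P w α q) = 0 := by
  have := letter_le_rowLen hw hq
  exact mem_range_nilOp_pow.1 ⟨v, rfl⟩ _ _ (by omega)

end Cells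

/-! ### The embedding of a word, its deformation, and their rank functions. -/

section Homs

variable {k : Type*} [Field k] {α β γ : YoungDiagram}

/-- A homomorphism given by one coordinate for each row `i` of `β` with a box in `β ∖ γ`, subject
to a condition on the column of this box. -/
def blockHom (k : Type*) [Field k] (α β γ : YoungDiagram) (A : ℕ → Prop) [DecidablePred A]
    (x : ℕ → ℕ × ℕ) : NilSpace k α →ₗ[k] NilSpace k β where
  toFun v c := if γ.rowLen c.1.1 < β.rowLen c.1.1 ∧ A (γ.rowLen c.1.1) then
    coord v ((x (γ.rowLen c.1.1)).1, (x (γ.rowLen c.1.1)).2 + c.1.2) else 0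
  map_add' v w := by
    funext c
    simp only [Pi.add_apply]
    split_ifs
    · rw [coord_add]
    · rw [add_zero]
  map_smul' r v := by
    funext c
    simp only [Pi.smul_apply, RingHom.id_apply]
    split_ifs
    · rw [coord_smul, smul_eq_mul]
    · rw [smul_zero]

/-- The bound `hx` leaves at most `γ_i + 1` boxes from the chosen box to the end of its row, so
nothing is cut off by row `i` of `β`. The formula then holds for all `m`, which makes commutation
with the operators immediate. -/
theorem coord_blockHom {A : ℕ → Prop} [DecidablePred A] {x : ℕ → ℕ × ℕ}
    (hx : ∀ i, γ.rowLen i < β.rowLen i → A (γ.rowLen i) →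
      α.rowLen (x (γ.rowLen i)).1 ≤ (x (γ.rowLen i)).2 + γ.rowLen i + 1)
    (v : NilSpace k α) (i m : ℕ) : coord (blockHom k α β γ A x v) (i, m) =
      if γ.rowLen i < β.rowLen i ∧ A (γ.rowLen i) then
        coord v ((x (γ.rowLen i)).1, (x (γ.rowLen i)).2 + m) else 0 := by
  by_cases hm : (i, m) ∈ β.cells
  · rw [coord, dif_pos hm]
    rfl
  · have hm' : (i, m) ∉ β := by simpa using hm
    rw [coord_of_notMem _ hm']
    split_ifs with h
    · rw [coord_of_notMem]
      intro hmem
      have h1 := hx i h.1 h.2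
      rw [YoungDiagram.mem_iff_lt_rowLen] at hm' hmem
      omega
    · rfl

/-- The embedding that belongs to a lattice word, and its deformation along the exchange of the
letters at `p₀` and `p₁`. -/
def wordHom (k : Type*) [Field k] (α β γ : YoungDiagram) (w : ℕ → ℕ) (p₀ p₁ : ℕ) (t : k) :
    NilSpace k α →ₗ[k] NilSpace k β :=
  blockHom k α β γ (fun _ => True) (chainCell (positions β.transpose γ.transpose) w α) +
    t • blockHom k α β γ (· = p₀) fun _ => chainCell (positions β.transpose γ.transpose) w α p₁

theorem rowLen_mem_positions {i : ℕ} (h : γ.rowLen i < β.rowLen i) :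
    γ.rowLen i ∈ positions β.transpose γ.transpose := by
  rw [mem_positions, YoungDiagram.rowLen_transpose, YoungDiagram.rowLen_transpose]
  have h1 : (i, γ.rowLen i) ∈ β := YoungDiagram.mem_iff_lt_rowLen.2 h
  have h2 : (i, γ.rowLen i) ∉ γ := fun h' => lt_irrefl _ (YoungDiagram.mem_iff_lt_rowLen.1 h')
  rw [YoungDiagram.mem_iff_lt_colLen] at h1 h2
  omega

theorem exists_rowLen_eq (hcol : IsVerticalStrip β γ) {q : ℕ}
    (hq : q ∈ positions β.transpose γ.transpose) :
    ∃ i, γ.rowLen i < β.rowLen i ∧ γ.rowLen i = q := by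
  rw [mem_positions, YoungDiagram.rowLen_transpose, YoungDiagram.rowLen_transpose] at hq
  have h1 : (γ.colLen q, q) ∈ β := YoungDiagram.mem_iff_lt_colLen.2 hq
  have h2 : (γ.colLen q, q) ∉ γ := fun h' => lt_irrefl _ (YoungDiagram.mem_iff_lt_colLen.1 h')
  have h3 := hcol (γ.colLen q)
  rw [YoungDiagram.mem_iff_lt_rowLen] at h1 h2
  exact ⟨γ.colLen q, by omega, by omega⟩

theorem coord_wordHom
    (hw : IsLatticeWord (positions β.transpose γ.transpose) α.transpose.rowLen w)
    (hex : Exchangeable (positions β.transpose γ.transpose) α.transpose.rowLen w p₀ p₁)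
    (t : k) (v : NilSpace k α) (i m : ℕ) :
    coord (wordHom k α β γ w p₀ p₁ t v) (i, m) = if γ.rowLen i < β.rowLen i then
      coord v ((chainCell (positions β.transpose γ.transpose) w α (γ.rowLen i)).1,
        (chainCell (positions β.transpose γ.transpose) w α (γ.rowLen i)).2 + m) +
      (if γ.rowLen i = p₀ then
        t * coord v ((chainCell (positions β.transpose γ.transpose) w α p₁).1,
          (chainCell (positions β.transpose γ.transpose) w α p₁).2 + m) else 0) else 0 := by
  rw [wordHom, LinearMap.add_apply, LinearMap.smul_apply, coord_add, coord_smul, coord_blockHom,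
    coord_blockHom]
  · by_cases h1 : γ.rowLen i < β.rowLen i
    · by_cases h2 : γ.rowLen i = p₀
      · subst h2
        simp [h1]
      · simp [h1, h2]
    · simp [h1]
  -- The letter of `p₁` must fit into the row that belongs to `p₀`; this is the letter bound for the
  -- exchanged word at `p₀`.
  · rintro i hi rfl
    have h0 := rowLen_mem_positions hi
    obtain ⟨hadj, -, hX⟩ := hex.2 h0
    have h1 := hX.letter_le h0
    rw [swapWord_left] at h1
    dsimp only [chainCell]
    omega
  · intro i hi _
    have := hw.letter_le (rowLen_mem_positions hi)
    dsimp only [chainCell]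
    omega

theorem wordHom_comm
    (hw : IsLatticeWord (positions β.transpose γ.transpose) α.transpose.rowLen w)
    (hex : Exchangeable (positions β.transpose γ.transpose) α.transpose.rowLen w p₀ p₁)
    (t : k) (v : NilSpace k α) :
    wordHom k α β γ w p₀ p₁ t (nilOp k α v) = nilOp k β (wordHom k α β γ w p₀ p₁ t v) := by
  refine ext_coord fun ⟨i, m⟩ => ?_
  rw [coord_nilOp, coord_wordHom hw hex, coord_wordHom hw hex, coord_nilOp, coord_nilOp, add_assoc,
    add_assoc]

/-- The socle coordinates of the image of `v` under `wordHom`. -/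
def socleCoord (P : Finset ℕ) (w : ℕ → ℕ) (p₀ p₁ : ℕ) (t : k) (q : ℕ) (v : NilSpace k α) : k :=
  coord v (chainCell P w α q) + if q = p₀ then t * coord v (chainCell P w α p₁) else 0

/-- Membership asks for vanishing in the last `j` columns of each row. A coordinate `m` columns into
the row of `q` comes from a chain member at a position at most `q - m`, so it is controlled by socle
coordinates before `j`. `Exchangeable.below` and `Exchangeable.above` keep this true for the mixed
coordinate at `p₀`. -/
theorem wordHom_mem_range_iff (hcol : IsVerticalStrip β γ)
    (hw : IsLatticeWord (positions β.transpose γ.transpose) α.transpose.rowLen w)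
    (hex : Exchangeable (positions β.transpose γ.transpose) α.transpose.rowLen w p₀ p₁)
    {t : k} {v : NilSpace k α} {j : ℕ} :
    wordHom k α β γ w p₀ p₁ t v ∈ LinearMap.range (nilOp k β ^ j) ↔
      ∀ q ∈ positions β.transpose γ.transpose, q < j →
        socleCoord (positions β.transpose γ.transpose) w p₀ p₁ t q v = 0 := by
  rw [mem_range_nilOp_pow]
  set P := positions β.transpose γ.transpose with hP
  constructor
  · intro h q hq hqj
    obtain ⟨i, hi, rfl⟩ := exists_rowLen_eq hcol hq
    have h1 := hcol i
    have h2 := h i 0 (by omega)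
    rw [coord_wordHom hw hex, if_pos hi] at h2
    exact h2
  · intro h i m hm
    rw [coord_wordHom hw hex]
    split_ifs with hi hp
    · have hiP := rowLen_mem_positions hi
      have h1 := hcol i
      rw [← hP] at hiP ⊢
      set p := γ.rowLen i
      rcases Nat.eq_zero_or_pos m with rfl | hm0
      · have h2 := h p hiP (by omega)
        rw [socleCoord, if_pos hp] at h2
        exact h2
      · have h0 : p₀ ∈ P := hp ▸ hiP
        have hz : ∀ q ∈ P, q < p₀ → q < j → coord v (chainCell P w α q) = 0 := fun q hq hq0 hqj => by
          have h2 := h q hq hqj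
          rwa [socleCoord, if_neg hq0.ne, add_zero] at h2
        rw [coord_chain_eq_zero hw v hiP, coord_chain_eq_zero hw v (hex.2 h0).1.2.1, mul_zero,
          add_zero]
        · intro q hq hl hc _
          have := hex.below h0 hq hm0 hc hl
          exact hz q hq (by omega) (by omega)
        · intro q hq hl hc hle
          exact hz q hq (by omega) (by omega)
    · have hiP := rowLen_mem_positions hi
      have h1 := hcol i
      rw [← hP] at hiP ⊢
      set p := γ.rowLen i
      rw [add_zero]
      refine coord_chain_eq_zero hw v hiP fun q hq hl hc hle => ?_
      have h2 := h q hq (by omega)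
      -- At `p₀` the socle coordinate is mixed with that of `p₁`. Since `p₁` also lies before `j`,
      -- its own coordinate vanishes and the mixture can be undone.
      by_cases hq0 : q = p₀
      · subst hq0
        have hm0 : 0 < m := Nat.pos_of_ne_zero fun hm0 => hp
          (eq_of_chainIdx_eq hiP hq (by omega) hc.symm)
        have h3 := hex.above hq hiP hm0 hc.symm hl
        have h4 := h p₁ (hex.2 hq).1.2.1 (by omega)
        rw [socleCoord, if_neg hex.1.symm, add_zero] at h4
        rw [socleCoord, if_pos rfl, h4, mul_zero, add_zero] at h2
        exact h2
      · rwa [socleCoord, if_neg hq0, add_zero] at h2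
    · rfl

theorem wordHom_injective (hcol : IsVerticalStrip β γ)
    (hw : IsLatticeWord (positions β.transpose γ.transpose) α.transpose.rowLen w)
    (hex : Exchangeable (positions β.transpose γ.transpose) α.transpose.rowLen w p₀ p₁)
    (t : k) : Function.Injective (wordHom k α β γ w p₀ p₁ t) := by
  rw [injective_iff_map_eq_zero]
  intro v hv
  set P := positions β.transpose γ.transpose with hP
  have h1 : ∀ q ∈ P, socleCoord P w p₀ p₁ t q v = 0 := fun q hq =>
    (wordHom_mem_range_iff hcol hw hex).1 (hv ▸ Submodule.zero_mem _) q hq (Nat.lt_succ_self q)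
  have h2 : ∀ q ∈ P, coord v (chainCell P w α q) = 0 := by
    intro q hq
    have h3 := h1 q hq
    by_cases hq0 : q = p₀
    · subst hq0
      have h4 := h1 p₁ (hex.2 hq).1.2.1
      rw [socleCoord, if_neg hex.1.symm, add_zero] at h4
      rwa [socleCoord, if_pos rfl, h4, mul_zero, add_zero] at h3
    · rwa [socleCoord, if_neg hq0, add_zero] at h3
  refine ext_coord fun c => ?_
  have hz : coord (0 : NilSpace k α) c = 0 := by
    unfold coord; split <;> rfl
  rw [hz]
  by_cases hc : c ∈ α
  · obtain ⟨q, hq, rfl, -⟩ := exists_chainCell_eq hw hc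
    exact h2 q hq
  · exact coord_of_notMem _ hc

theorem finrank_range_eq_of_ker_eq {V V' : Type*} [AddCommGroup V] [Module k V]
    [FiniteDimensional k V] [AddCommGroup V'] [Module k V'] (L : V →ₗ[k] V') (S : Finset ℕ)
    (Ψ : V →ₗ[k] (S → k)) (hΨ : Function.Surjective Ψ)
    (h : LinearMap.ker L = LinearMap.ker Ψ) : finrank k (LinearMap.range L) = S.card := by
  have h1 := LinearMap.finrank_range_add_finrank_ker L
  have h2 := LinearMap.finrank_range_add_finrank_ker Ψ
  rw [LinearMap.range_eq_top.2 hΨ, finrank_top, finrank_fintype_fun_eq_card,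
    Fintype.card_coe] at h2
  rw [h] at h1
  omega

/-- The functional on `N_α` that is the socle coordinate after applying `T ^ ℓ`. -/
def socleMap (P : Finset ℕ) (w : ℕ → ℕ) (p₀ p₁ : ℕ) (t : k) (ℓ : ℕ) (S : Finset ℕ) :
    NilSpace k α →ₗ[k] (S → k) where
  toFun v q := socleCoord P w p₀ p₁ t q ((nilOp k α ^ ℓ) v)
  map_add' v v' := by
    funext q
    simp only [socleCoord, map_add, coord_add, Pi.add_apply]
    split_ifs <;> ring
  map_smul' r v := by
    funext q
    simp only [socleCoord, map_smul, coord_smul, Pi.smul_apply, RingHom.id_apply, smul_eq_mul]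
    split_ifs <;> ring

theorem homRank_wordHom_eq_card (hcol : IsVerticalStrip β γ)
    (hw : IsLatticeWord (positions β.transpose γ.transpose) α.transpose.rowLen w)
    (hex : Exchangeable (positions β.transpose γ.transpose) α.transpose.rowLen w p₀ p₁)
    {t s : k} {j ℓ : ℕ} {S : Finset ℕ}
    (hts : ∀ v : NilSpace k α, (∀ q ∈ positions β.transpose γ.transpose, q < j →
        socleCoord (positions β.transpose γ.transpose) w p₀ p₁ t q ((nilOp k α ^ ℓ) v) = 0) ↔
      ∀ q ∈ S, socleCoord (positions β.transpose γ.transpose) w p₀ p₁ s q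
        ((nilOp k α ^ ℓ) v) = 0)
    (hS : Function.Surjective
      (socleMap (α := α) (positions β.transpose γ.transpose) w p₀ p₁ s ℓ S)) :
    homRank (wordHom k α β γ w p₀ p₁ t) j ℓ = S.card := by
  rw [homRank_eq]
  refine finrank_range_eq_of_ker_eq _ S _ hS ?_
  ext v
  have h1 : ∀ v, ((LinearMap.range (nilOp k β ^ j)).mkQ ∘ₗ (nilOp k β ^ ℓ)) v = 0 ↔
      (nilOp k β ^ ℓ) v ∈ LinearMap.range (nilOp k β ^ j) := fun v =>
    Submodule.Quotient.mk_eq_zero _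
  rw [LinearMap.mem_ker, LinearMap.mem_ker, LinearMap.comp_apply, h1,
    ← comm_pow (wordHom_comm hw hex t), wordHom_mem_range_iff hcol hw hex, hts, funext_iff]
  exact ⟨fun h q => h q q.2, fun h q hq => h ⟨q, hq⟩⟩

theorem socleCoord_zero (P : Finset ℕ) (w : ℕ → ℕ) (p₀ p₁ q : ℕ) (v : NilSpace k α) :
    socleCoord P w p₀ p₁ 0 q v = coord v (chainCell P w α q) := by
  simp [socleCoord]

/-- On `T^ℓ N_α` the undeformed socle coordinates with letter at most `ℓ` vanish and the others are
independent, so the rank counts letters above `ℓ`. -/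
theorem homRank_wordHom_of_iff (hcol : IsVerticalStrip β γ)
    (hw : IsLatticeWord (positions β.transpose γ.transpose) α.transpose.rowLen w)
    (hex : Exchangeable (positions β.transpose γ.transpose) α.transpose.rowLen w p₀ p₁)
    {t : k} {j : ℕ} (ℓ : ℕ)
    (hts : ∀ v : NilSpace k α, (∀ q ∈ positions β.transpose γ.transpose, q < j →
        socleCoord (positions β.transpose γ.transpose) w p₀ p₁ t q v = 0) ↔
      ∀ q ∈ positions β.transpose γ.transpose, q < j →
        socleCoord (positions β.transpose γ.transpose) w p₀ p₁ 0 q v = 0) :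
    homRank (wordHom k α β γ w p₀ p₁ t) j ℓ =
      cnt (positions β.transpose γ.transpose) w (ℓ < ·) j := by
  rw [cnt_eq_card]
  refine homRank_wordHom_eq_card hcol hw hex (s := 0) (fun v => (hts _).trans ⟨?_, ?_⟩) ?_
  · intro h q hq
    rw [Finset.mem_filter] at hq
    exact h q hq.1 hq.2.1
  · intro h q hq hqj
    by_cases hl : ℓ < w q
    · exact h q (Finset.mem_filter.2 ⟨hq, hqj, hl⟩)
    · rw [socleCoord_zero, coord_nilOp_pow_chainCell hw hq (not_lt.1 hl)]
  · intro y
    obtain ⟨v, hv⟩ := exists_coord_nilOp_pow (k := k) hw ℓ fun q =>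
      if h : q ∈ (positions β.transpose γ.transpose).filter fun q => q < j ∧ ℓ < w q then
        y ⟨q, h⟩ else 0
    refine ⟨v, funext fun q => ?_⟩
    have hq := Finset.mem_filter.1 q.2
    change socleCoord _ _ _ _ _ _ _ = _
    rw [socleCoord_zero, hv q hq.1, if_pos hq.2.2, dif_pos q.2]

theorem homRank_wordHom_zero (hcol : IsVerticalStrip β γ)
    (hw : IsLatticeWord (positions β.transpose γ.transpose) α.transpose.rowLen w)
    (hex : Exchangeable (positions β.transpose γ.transpose) α.transpose.rowLen w p₀ p₁) (ℓ j : ℕ) :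
    homRank (wordHom k α β γ w p₀ p₁ 0) j ℓ =
      cnt (positions β.transpose γ.transpose) w (ℓ < ·) j :=
  homRank_wordHom_of_iff hcol hw hex ℓ fun _ => Iff.rfl

/-- If both or neither of `p₀`, `p₁` lie before `j`, the deformation does not change the common
kernel. If only `p₀` does, its functional has the term of `p₁` with coefficient `t ≠ 0`, which
survives on `T^ℓ N_α` as long as `ℓ` is below the larger letter: `p₀` acts as if it carried the
letter of `p₁`. -/
theorem homRank_wordHom_of_ne_zero (hcol : IsVerticalStrip β γ)
    (hw : IsLatticeWord (positions β.transpose γ.transpose) α.transpose.rowLen w)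
    (hex : Exchangeable (positions β.transpose γ.transpose) α.transpose.rowLen w p₀ p₁)
    (h0 : p₀ ∈ positions β.transpose γ.transpose) {t : k} (ht : t ≠ 0) (ℓ j : ℕ) :
    homRank (wordHom k α β γ w p₀ p₁ t) j ℓ =
      cnt (positions β.transpose γ.transpose) (swapWord w p₀ p₁) (ℓ < ·) j := by
  obtain ⟨hadj, hlt, hX⟩ := hex.2 h0
  set P := positions β.transpose γ.transpose with hP
  have hne : ∀ q, q ≠ p₀ → ∀ (s : k) (v : NilSpace k α),
      socleCoord P w p₀ p₁ s q v = coord v (chainCell P w α q) := fun q hq s v => by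
    rw [socleCoord, if_neg hq, add_zero]
  rcases le_or_gt j p₀ with hj | hj
  · rw [cnt_swapWord_of_le hadj hj]
    refine homRank_wordHom_of_iff hcol hw hex ℓ fun v => ?_
    refine forall_congr' fun q => forall_congr' fun hq => forall_congr' fun hqj => ?_
    rw [hne q (by omega), hne q (by omega)]
  rcases lt_or_ge p₁ j with hj' | hj'
  · rw [cnt_swapWord_of_lt hadj hj']
    refine homRank_wordHom_of_iff hcol hw hex ℓ fun v => ?_
    refine ⟨fun h q hq hqj => ?_, fun h q hq hqj => ?_⟩ <;>
    · have h1 := h p₁ hadj.2.1 hj'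
      rw [hne p₁ hex.1.symm] at h1
      have h2 := h q hq hqj
      unfold socleCoord at h2 ⊢
      rw [h1] at h2 ⊢
      simpa using h2
  have hpq := hadj.2.2.1
  have hw' : ∀ q ∈ P, q < j → q ≠ p₀ → swapWord w p₀ p₁ q = w q := fun q _ hqj hq =>
    swapWord_of_ne hq (by omega)
  rw [cnt_eq_card]
  refine homRank_wordHom_eq_card hcol hw hex (s := t) (fun v => ⟨?_, ?_⟩) ?_
  · intro h q hq
    rw [Finset.mem_filter] at hq
    exact h q hq.1 hq.2.1
  · intro h q hq hqj
    by_cases hl : ℓ < swapWord w p₀ p₁ q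
    · exact h q (Finset.mem_filter.2 ⟨hq, hqj, hl⟩)
    · by_cases hq0 : q = p₀
      · subst hq0
        rw [swapWord_left] at hl
        rw [socleCoord, if_pos rfl, coord_nilOp_pow_chainCell hw hq (by omega),
          coord_nilOp_pow_chainCell hw hadj.2.1 (by omega), mul_zero, add_zero]
      · rw [hw' q hq hqj hq0] at hl
        rw [hne q hq0, coord_nilOp_pow_chainCell hw hq (not_lt.1 hl)]
  · intro y
    -- The value wanted at `p₀` is produced by the coordinate at `p₁`, scaled by `t⁻¹`. That
    -- coordinate is free because `p₁` is not before `j`.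
    obtain ⟨v, hv⟩ := exists_coord_nilOp_pow (k := k) hw ℓ fun q =>
      if q = p₀ then 0 else if q = p₁ then
        (if h : p₀ ∈ P.filter fun q => q < j ∧ ℓ < swapWord w p₀ p₁ q then t⁻¹ * y ⟨p₀, h⟩ else 0)
      else if h : q ∈ P.filter fun q => q < j ∧ ℓ < swapWord w p₀ p₁ q then y ⟨q, h⟩ else 0
    refine ⟨v, funext fun ⟨q, hqS⟩ => ?_⟩
    have hq := Finset.mem_filter.1 hqS
    change socleCoord _ _ _ _ _ _ _ = _
    by_cases hq0 : q = p₀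
    · subst hq0
      have hl := hq.2.2
      rw [swapWord_left] at hl
      rw [socleCoord, if_pos rfl, hv q h0, hv p₁ hadj.2.1, if_pos rfl, ite_self, zero_add,
        if_pos hl, if_neg hex.1.symm, if_pos rfl, dif_pos hqS, mul_inv_cancel_left₀ ht]
    · have hl := hq.2.2
      rw [hw' q hq.1 hq.2.1 hq0] at hl
      rw [hne q hq0, hv q hq.1, if_pos hl, if_neg hq0, if_neg (by have := hq.2.1; omega),
        dif_pos hqS]

end Homs
end Construction

/-! ### Open and closed components -/

section Components

variable {k : Type*} [Field k] {α β γ : YoungDiagram}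

theorem IsHorizontalStrip.transpose_of_isVerticalStrip (h : IsVerticalStrip β γ) :
    IsHorizontalStrip β.transpose γ.transpose := by
  unfold IsHorizontalStrip
  rwa [YoungDiagram.transpose_transpose, YoungDiagram.transpose_transpose]

theorem exists_mem_component_of_homRank (hγβ : γ ≤ β) (hrow : IsHorizontalStrip β γ)
    (X : LRFilling α.transpose β.transpose γ.transpose) {f : NilSpace k α →ₗ[k] NilSpace k β}
    (hf : ∀ v, f (nilOp k α v) = nilOp k β (f v)) (hinj : Function.Injective f)
    (h : ∀ ℓ j, homRank f j ℓ = cnt (positions β.transpose γ.transpose) X.word (ℓ < ·) j) :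
    ∃ F : SESVariety k α β γ, F.1 = f ∧ F ∈ component k X := by
  have h0 := (quotHasJordanType_transpose_iff hf hγβ hrow X 0).2 (h 0)
  rw [X.region_zero (YoungDiagram.transpose_mono hγβ), YoungDiagram.transpose_transpose, pow_zero,
    Module.End.one_eq_id, Submodule.map_id] at h0
  exact ⟨⟨f, hf, hinj, h0⟩, rfl, (mem_component_iff hγβ hrow X _).2 h⟩

theorem component_nonempty (hγβ : γ ≤ β) (hrow : IsHorizontalStrip β γ)
    (hcol : IsVerticalStrip β γ) (X : LRFilling α.transpose β.transpose γ.transpose) :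
    (component k X).Nonempty := by
  have hw := X.isLatticeWord hrow (.transpose_of_isVerticalStrip hcol)
  set P := positions β.transpose γ.transpose with hP
  -- The successor of the largest position is not in `P`, so the exchange condition is void.
  have hex : Exchangeable P α.transpose.rowLen X.word (P.sup id + 1) (P.sup id) :=
    ⟨Nat.succ_ne_self _, fun h => absurd (lt_add_sup h) (lt_irrefl _)⟩
  obtain ⟨F, -, hF⟩ := exists_mem_component_of_homRank (k := k) hγβ hrow X
    (wordHom_comm hw hex 0) (wordHom_injective hcol hw hex 0)
    (homRank_wordHom_zero hcol hw hex)
  exact ⟨F, hF⟩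

/-- The filling `Z` arises from `X` by exchanging an adjacent descent of its word. -/
def IsExchange (X Z : LRFilling α.transpose β.transpose γ.transpose) : Prop :=
  ∃ p q, Adjacent (positions β.transpose γ.transpose) p q ∧ Z.word p < Z.word q ∧
    ∀ r ∈ positions β.transpose γ.transpose, X.word r = swapWord Z.word p q r

theorem IsExchange.lt (hγβ : γ ≤ β) (hrow : IsHorizontalStrip β γ)
    {X Z : LRFilling α.transpose β.transpose γ.transpose} (h : IsExchange X Z) : X < Z := by
  obtain ⟨p, q, hadj, hlt, hX⟩ := h
  refine lt_of_le_of_ne ?_ ?_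
  · rw [LRFilling.le_iff (YoungDiagram.transpose_mono hγβ) hrow]
    intro ℓ j
    rw [cnt_congr fun r hr _ => hX r hr]
    exact cnt_le_cnt_swapWord hadj hlt ℓ j
  · rintro rfl
    have := hX p hadj.1
    rw [swapWord_left] at this
    omega

/-- A line in the variety that meets `𝕍_Z` in one point and lies in `𝕍_X` otherwise. -/
theorem IsExchange.exists_line (hγβ : γ ≤ β) (hrow : IsHorizontalStrip β γ)
    (hcol : IsVerticalStrip β γ) {X Z : LRFilling α.transpose β.transpose γ.transpose}
    (h : IsExchange X Z) : ∃ (F : k → SESVariety k α β γ) (f g : NilSpace k α →ₗ[k] NilSpace k β),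
      (∀ t, (F t).1 = f + t • g) ∧ F 0 ∈ component k Z ∧ ∀ t, t ≠ 0 → F t ∈ component k X := by
  obtain ⟨p, q, hadj, hlt, hX⟩ := h
  have hcol' := IsHorizontalStrip.transpose_of_isVerticalStrip hcol
  have hw := Z.isLatticeWord hrow hcol'
  have hwX := X.isLatticeWord hrow hcol'
  set P := positions β.transpose γ.transpose with hP
  have hsw : IsLatticeWord P α.transpose.rowLen (swapWord Z.word p q) :=
    { pos := fun r hr => hX r hr ▸ hwX.pos r hr
      content := fun u => by
        rw [← hwX.content u]
        exact congrArg _ (Finset.filter_congr fun r hr => by rw [hX r hr])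
      lattice := fun u hu j => by
        rw [← cnt_congr fun r hr _ => hX r hr, ← cnt_congr fun r hr _ => hX r hr]
        exact hwX.lattice u hu j }
  have hex : Exchangeable P α.transpose.rowLen Z.word p q :=
    ⟨hadj.2.2.1.ne, fun _ => ⟨hadj, hlt, hsw⟩⟩
  have key : ∀ t : k, ∃ F : SESVariety k α β γ, F.1 = wordHom k α β γ Z.word p q t ∧
      (t = 0 → F ∈ component k Z) ∧ (t ≠ 0 → F ∈ component k X) := by
    intro t
    rcases eq_or_ne t 0 with rfl | ht
    · obtain ⟨F, hF, hFZ⟩ := exists_mem_component_of_homRank (k := k) hγβ hrow Z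
        (wordHom_comm hw hex 0) (wordHom_injective hcol hw hex 0)
        (homRank_wordHom_zero hcol hw hex)
      exact ⟨F, hF, fun _ => hFZ, fun h => absurd rfl h⟩
    · obtain ⟨F, hF, hFX⟩ := exists_mem_component_of_homRank (k := k) hγβ hrow X
        (wordHom_comm hw hex t) (wordHom_injective hcol hw hex t) fun ℓ j => by
          rw [homRank_wordHom_of_ne_zero hcol hw hex hadj.1 ht]
          exact (cnt_congr fun r hr _ => hX r hr).symm
      exact ⟨F, hF, fun h => absurd h ht, fun _ => hFX⟩
  choose F hF hFZ hFX using key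
  exact ⟨F, _, _, hF, hFZ 0 rfl, hFX⟩

theorem IsExchange.not_isClosed [Infinite k] (hγβ : γ ≤ β) (hrow : IsHorizontalStrip β γ)
    (hcol : IsVerticalStrip β γ) {X Z : LRFilling α.transpose β.transpose γ.transpose}
    (h : IsExchange X Z) : ¬ IsClosed (component k X) := by
  obtain ⟨F, f, g, hF, hFZ, hFX⟩ := h.exists_line (k := k) hγβ hrow hcol
  intro hcl
  exact (h.lt hγβ hrow).ne
    (eq_of_mem_component hγβ hrow (mem_of_isClosed_of_line hcl hF hFX) hFZ)

theorem IsExchange.not_isOpen [Infinite k] (hγβ : γ ≤ β) (hrow : IsHorizontalStrip β γ)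
    (hcol : IsVerticalStrip β γ) {X Z : LRFilling α.transpose β.transpose γ.transpose}
    (h : IsExchange X Z) : ¬ IsOpen (component k Z) := by
  obtain ⟨F, f, g, hF, hFZ, hFX⟩ := h.exists_line (k := k) hγβ hrow hcol
  intro hop
  refine mem_of_isClosed_of_line hop.isClosed_compl hF (fun t ht hZ => ?_) hFZ
  exact (h.lt hγβ hrow).ne (eq_of_mem_component hγβ hrow (hFX t ht) hZ)

/-- A filling without a downward exchange has no admissible ascent in its word, and there is only
one such word. -/
theorem exists_isExchange_left (hrow : IsHorizontalStrip β γ) (hcol : IsVerticalStrip β γ)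
    {O Z : LRFilling α.transpose β.transpose γ.transpose} (hO : ∀ X, ¬ IsExchange X O)
    (hZ : Z ≠ O) : ∃ X, IsExchange X Z := by
  by_contra! hno
  have hcol' := IsHorizontalStrip.transpose_of_isVerticalStrip hcol
  have key : ∀ Z : LRFilling α.transpose β.transpose γ.transpose, (∀ X, ¬ IsExchange X Z) →
      ∀ p q, Adjacent (positions β.transpose γ.transpose) p q → Z.word p < Z.word q →
        chainIdx (positions β.transpose γ.transpose) Z.word p ≤
          chainIdx (positions β.transpose γ.transpose) Z.word q := by
    intro Z hZ p q hadj hlt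
    by_contra! hc
    have hw := (Z.isLatticeWord hrow hcol').swapWord_of_chainIdx_lt hadj hlt hc
    exact hZ (LRFilling.ofWord hrow hcol' _ hw)
      ⟨p, q, hadj, hlt, fun r hr => LRFilling.word_ofWord hrow hcol' hw hr⟩
  exact hZ (LRFilling.ext_word hrow ((Z.isLatticeWord hrow hcol').eqOn_of_no_ascent
    (O.isLatticeWord hrow hcol') (key Z hno) (key O hO)))

theorem exists_isExchange_right (hrow : IsHorizontalStrip β γ) (hcol : IsVerticalStrip β γ)
    {C X : LRFilling α.transpose β.transpose γ.transpose} (hC : ∀ Z, ¬ IsExchange C Z)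
    (hX : X ≠ C) : ∃ Z, IsExchange X Z := by
  by_contra! hno
  have hcol' := IsHorizontalStrip.transpose_of_isVerticalStrip hcol
  have key : ∀ X : LRFilling α.transpose β.transpose γ.transpose, (∀ Z, ¬ IsExchange X Z) →
      ∀ p q, Adjacent (positions β.transpose γ.transpose) p q → X.word p ≤ X.word q := by
    intro X hX p q hadj
    by_contra! hlt
    have hw := (X.isLatticeWord hrow hcol').swapWord_of_lt hadj hlt
    have hword : ∀ r ∈ positions β.transpose γ.transpose,
        (LRFilling.ofWord hrow hcol' _ hw).word r = swapWord X.word p q r := fun r hr =>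
      LRFilling.word_ofWord hrow hcol' hw hr
    refine hX (LRFilling.ofWord hrow hcol' _ hw) ⟨p, q, hadj, ?_, fun r hr => ?_⟩
    · rwa [hword p hadj.1, hword q hadj.2.1, swapWord_left, swapWord_right]
    -- The relation `IsExchange` starts from the upper filling, so `X` has to be recovered from the
    -- new one by exchanging back.
    · by_cases hp : r = p
      · rw [hp, swapWord_left, hword q hadj.2.1, swapWord_right]
      by_cases hq : r = q
      · rw [hq, swapWord_right, hword p hadj.1, swapWord_left]
      rw [swapWord_of_ne hp hq, hword r hr, swapWord_of_ne hp hq]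
  exact hX (LRFilling.ext_word hrow ((X.isLatticeWord hrow hcol').eqOn_of_no_descent
    (C.isLatticeWord hrow hcol') (key X hno) (key C hC)))

theorem exists_cnt_lt_of_not_le (hγβ : γ ≤ β) (hrow : IsHorizontalStrip β γ)
    {X Z : LRFilling α.transpose β.transpose γ.transpose} (h : ¬ X ≤ Z) :
    ∃ ℓ j, cnt (positions β.transpose γ.transpose) X.word (ℓ < ·) j <
      cnt (positions β.transpose γ.transpose) Z.word (ℓ < ·) j := by
  rw [LRFilling.le_iff (YoungDiagram.transpose_mono hγβ) hrow] at h
  push Not at h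
  exact h

/-- Every other filling `Y` fails `Y ≤ O`, hence has a rank strictly smaller than that of `O`
somewhere. One lower rank bound for each `Y` cuts out the component, and finiteness of the set of
fillings keeps the intersection open. -/
theorem isOpen_component_of_isMin (hγβ : γ ≤ β) (hrow : IsHorizontalStrip β γ)
    (hcol : IsVerticalStrip β γ) {O : LRFilling α.transpose β.transpose γ.transpose}
    (hO : IsMin O) : IsOpen (component k O) := by
  have := LRFilling.finite (a := α.transpose) hrow (.transpose_of_isVerticalStrip hcol)
  have hex : ∀ Y : {Y // Y ≠ O}, ∃ ℓ j, cnt (positions β.transpose γ.transpose) Y.1.word (ℓ < ·) j <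
      cnt (positions β.transpose γ.transpose) O.word (ℓ < ·) j := fun Y =>
    exists_cnt_lt_of_not_le hγβ hrow fun h => Y.2 (hO.eq_of_le h)
  choose ℓ j hlt using hex
  have : component k O = ⋂ Y : {Y // Y ≠ O}, {f : SESVariety k α β γ |
      cnt (positions β.transpose γ.transpose) O.word (ℓ Y < ·) (j Y) ≤
        homRank f.1 (j Y) (ℓ Y)} := by
    ext f
    rw [Set.mem_iInter]
    constructor
    · intro hf Y
      rw [Set.mem_ofPred_eq, (mem_component_iff hγβ hrow O f).1 hf]
    · intro hf
      obtain ⟨Y, hY⟩ := exists_mem_component hγβ hrow hcol f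
      by_cases hYO : Y = O
      · exact hYO ▸ hY
      · have h1 := hf ⟨Y, hYO⟩
        rw [Set.mem_ofPred_eq, (mem_component_iff hγβ hrow Y f).1 hY] at h1
        exact absurd h1 (not_le.2 (hlt ⟨Y, hYO⟩))
  rw [this]
  exact isOpen_iInter_of_finite fun Y => isOpen_le_homRank _ _ _

/-- Dually, every other filling exceeds `C` in some rank, and upper rank bounds are closed
conditions. -/
theorem isClosed_component_of_isMax (hγβ : γ ≤ β) (hrow : IsHorizontalStrip β γ)
    (hcol : IsVerticalStrip β γ) {C : LRFilling α.transpose β.transpose γ.transpose}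
    (hC : IsMax C) : IsClosed (component k C) := by
  have hex : ∀ Y : {Y // Y ≠ C}, ∃ ℓ j, cnt (positions β.transpose γ.transpose) C.word (ℓ < ·) j <
      cnt (positions β.transpose γ.transpose) Y.1.word (ℓ < ·) j := fun Y =>
    exists_cnt_lt_of_not_le hγβ hrow fun h => Y.2 (hC.eq_of_ge h)
  choose ℓ j hlt using hex
  have : component k C = ⋂ Y : {Y // Y ≠ C}, {f : SESVariety k α β γ |
      cnt (positions β.transpose γ.transpose) C.word (ℓ Y < ·) (j Y) + 1 ≤
        homRank f.1 (j Y) (ℓ Y)}ᶜ := by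
    ext f
    rw [Set.mem_iInter]
    constructor
    · intro hf Y
      rw [Set.mem_compl_iff, Set.mem_ofPred_eq, (mem_component_iff hγβ hrow C f).1 hf]
      exact Nat.not_succ_le_self _
    · intro hf
      obtain ⟨Y, hY⟩ := exists_mem_component hγβ hrow hcol f
      by_cases hYC : Y = C
      · exact hYC ▸ hY
      · have h1 := hf ⟨Y, hYC⟩
        rw [Set.mem_compl_iff, Set.mem_ofPred_eq, (mem_component_iff hγβ hrow Y f).1 hY] at h1
        exact absurd (hlt ⟨Y, hYC⟩) h1
  rw [this]
  exact isClosed_iInter fun Y => (isOpen_le_homRank _ _ _).isClosed_compl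

end Components
end LRVar

theorem mainTheorem7 {k : Type*} [Field k] [IsAlgClosed k] (α β γ : YoungDiagram)
    (hγβ : γ ≤ β) (hrook : LRVar.IsRookStrip β γ)
    (hne : Nonempty (LRVar.LRFilling α.transpose β.transpose γ.transpose)) :
    (⋃ X : LRVar.LRFilling α.transpose β.transpose γ.transpose, LRVar.component k X) = Set.univ ∧
    Pairwise (fun X Y : LRVar.LRFilling α.transpose β.transpose γ.transpose =>
      Disjoint (LRVar.component k X) (LRVar.component k Y)) ∧
    (∀ X : LRVar.LRFilling α.transpose β.transpose γ.transpose,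
      (LRVar.component k X).Nonempty) ∧
    ∃ O C : LRVar.LRFilling α.transpose β.transpose γ.transpose,
      (∀ X, IsMin X ↔ X = O) ∧
      (∀ X, IsMax X ↔ X = C) ∧
      (∀ X, IsOpen (LRVar.component k X) ↔ X = O) ∧
      (∀ X, IsClosed (LRVar.component k X) ↔ X = C) := by
  obtain ⟨hrow, hcol⟩ := hrook
  have := LRVar.LRFilling.finite (a := α.transpose) hrow (.transpose_of_isVerticalStrip hcol)
  refine ⟨Set.eq_univ_of_forall fun f => Set.mem_iUnion.2
      (LRVar.exists_mem_component hγβ hrow hcol f),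
    fun X Y hXY => Set.disjoint_left.2 fun f hX hY =>
      hXY (LRVar.eq_of_mem_component hγβ hrow hX hY),
    LRVar.component_nonempty hγβ hrow hcol, ?_⟩
  obtain ⟨O, hO⟩ : ∃ O : LRVar.LRFilling α.transpose β.transpose γ.transpose, IsMin O := by
    obtain ⟨O, hO⟩ := Set.finite_univ.exists_minimal
      (Set.univ_nonempty (α := LRVar.LRFilling α.transpose β.transpose γ.transpose))
    exact ⟨O, fun Y hY => hO.2 (Set.mem_univ Y) hY⟩
  obtain ⟨C, hC⟩ : ∃ C : LRVar.LRFilling α.transpose β.transpose γ.transpose, IsMax C := by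
    obtain ⟨C, hC⟩ := Set.finite_univ.exists_maximal
      (Set.univ_nonempty (α := LRVar.LRFilling α.transpose β.transpose γ.transpose))
    exact ⟨C, fun Y hY => hC.2 (Set.mem_univ Y) hY⟩
  -- An exchange strictly lowers a filling, so a minimal one admits none; this is all that the
  -- uniqueness argument needs from `O`.
  have hO' : ∀ X, X ≠ O → ∃ Y, LRVar.IsExchange Y X := fun X =>
    LRVar.exists_isExchange_left hrow hcol fun Y hY => hO.not_lt (hY.lt hγβ hrow)
  have hC' : ∀ X, X ≠ C → ∃ Y, LRVar.IsExchange X Y := fun X =>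
    LRVar.exists_isExchange_right hrow hcol fun Y hY => hC.not_lt (hY.lt hγβ hrow)
  refine ⟨O, C, fun X => ⟨fun h => ?_, ?_⟩, fun X => ⟨fun h => ?_, ?_⟩, fun X => ⟨fun h => ?_, ?_⟩,
    fun X => ⟨fun h => ?_, ?_⟩⟩
  · by_contra hX
    obtain ⟨Y, hY⟩ := hO' X hX
    exact h.not_lt (hY.lt hγβ hrow)
  · rintro rfl
    exact hO
  · by_contra hX
    obtain ⟨Y, hY⟩ := hC' X hX
    exact h.not_lt (hY.lt hγβ hrow)
  · rintro rfl
    exact hC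
  · by_contra hX
    obtain ⟨Y, hY⟩ := hO' X hX
    exact hY.not_isOpen hγβ hrow hcol h
  · rintro rfl
    exact LRVar.isOpen_component_of_isMin hγβ hrow hcol hO
  · by_contra hX
    obtain ⟨Y, hY⟩ := hC' X hX
    exact hY.not_isClosed hγβ hrow hcol h
  · rintro rfl
    exact LRVar.isClosed_component_of_isMax hγβ hrow hcol hC
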